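/- Consider bias-free fully connected networks with $L\ge 1$ layers, $f(w,x)=w_L\,\varphi_{L-1}(w_{L-1}\cdots\varphi_1(w_1x))$, where $w_l\in\mathbb R^{n_l\times n_{l-1}}$, all widths satisfy $n_0,\dots,n_L\le d$, there are $n_L\ge 2$ classes, and the activations $\varphi_l:\mathbb R\to\mathbb R$ are applied entrywise, are $1$-Lipschitz and satisfy $\varphi_l(0)=0$. The training set $S$ consists of $D\ge2$ independent labelled examples $(x_k,y_k)$; the example $k$ is drawn from the law $\mu_{c(k)}$ of the client $c(k)\in\{1,\dots,m\}$ holding it (the client laws may differ), and every client law is supported on inputs with $\|x\|_2\le L_n$. Let $\mathbb D=\frac1D\sum_{k}\mu_{c(k)}$ be the pooled law. For a predictor $g$ and $\epsilon\ge0$ put $$G_\epsilon(g)=\mathbb P_{(x,y)\sim\mathbb D}\Big(g(x)[y]\le\max_{j\ne y}g(x)[j]+\epsilon\Big),\qquad \widetilde G_\epsilon(g)=\frac1D\#\Big\{k:\ g(x_k)[y_k]\le\max_{j\ne y_k}g(x_k)[j]+\epsilon\Big\}.$$ For every $\epsilon_{\max}>0$ there is a constant $C>0$, depending only on $\epsilon_{\max}$,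 such that for all such networks and data, all $0<\epsilon\le\epsilon_{\max}$ and all $p>0$, the following holds with probability at least $1-p$ over $S$. For all weights $w$ with every $w_l\neq0$ (in particular for the global model that FedSMOO, or any other training procedure, produces from $S$) and all perturbations $s$ (which may depend on $S$ and $w$) with $\|s_l\|\le\|w_l\|/L$ and $\|s_l\|_F\le\|w_l\|_F$ for every layer $l$, $$G_0\big(f(w+s,\cdot)\big)\ \le\ \widetilde G_\epsilon\big(f(w+s,\cdot)\big)+C\sqrt{\frac{L^2L_n^2\,d\,\ln(dL)\,\mathcal V_L+\ln\frac{LD}{p}}{(D-1)\,\epsilon^2}},\qquad \mathcal V_L=\prod_{l=1}^L\|w_l\|^2\sum_{l=1}^L\frac{\|w_l\|_F^2}{\|w_l\|^2},$$ where $\|\cdot\|$ is the spectral norm and $\|\cdot\|_F$ the Frobenius norm. -/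

import Mathlib

open MeasureTheory
open scoped ENNReal

noncomputable section

namespace FedMargin

/-- The weights of a bias-free fully connected network: `w l` is the matrix of layer `l + 1`, of size
`n (l + 1) × n l`, where `n 0` is the input dimension and `n l` the width of layer `l`. A network with
`L` layers uses only `w 0, …, w (L - 1)`. -/
abbrev Weights (n : ℕ → ℕ) : Type :=
  (l : ℕ) → Matrix (Fin (n (l + 1))) (Fin (n l)) ℝ

/-- Multiplication of a Euclidean vector by a matrix. -/
def linLayer {a b : ℕ} (A : Matrix (Fin b) (Fin a) ℝ) (x : EuclideanSpace ℝ (Fin a)) :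
    EuclideanSpace ℝ (Fin b) :=
  WithLp.toLp 2 (A.mulVec x.ofLp)

/-- Entrywise application of an activation function. -/
def actLayer {a : ℕ} (φ : ℝ → ℝ) (x : EuclideanSpace ℝ (Fin a)) : EuclideanSpace ℝ (Fin a) :=
  WithLp.toLp 2 (fun i => φ (x.ofLp i))

/-- The output of the `L`-layer network `x ↦ w_L φ_{L-1}(w_{L-1} ⋯ φ_1(w_1 x))`: an activation acts
between consecutive layers, and neither the input nor the output is activated. -/
def network {n : ℕ → ℕ} (φ : ℕ → ℝ → ℝ) (w : Weights n) :
    (L : ℕ) → EuclideanSpace ℝ (Fin (n 0)) → EuclideanSpace ℝ (Fin (n L))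
  | 0, x => x
  | 1, x => linLayer (w 0) x
  | l + 2, x => linLayer (w (l + 1)) (actLayer (φ l) (network φ w (l + 1) x))

open scoped Matrix.Norms.L2Operator in
/-- The spectral norm `‖A‖`. -/
def specNorm {a b : ℕ} (A : Matrix (Fin b) (Fin a) ℝ) : ℝ := ‖A‖

open scoped Matrix.Norms.Frobenius in
/-- The Frobenius norm `‖A‖_F`. -/
def frobNorm {a b : ℕ} (A : Matrix (Fin b) (Fin a) ℝ) : ℝ := ‖A‖

/-- `V_L = ∏ ‖w_l‖² · ∑ ‖w_l‖_F² / ‖w_l‖²`. -/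
def complexityV {n : ℕ → ℕ} (L : ℕ) (w : Weights n) : ℝ :=
  (∏ l ∈ Finset.range L, specNorm (w l) ^ 2) *
    ∑ l ∈ Finset.range L, frobNorm (w l) ^ 2 / specNorm (w l) ^ 2

/-- Labelled examples: an input in `ℝ^a` and one of `K` class labels. -/
abbrev Example (a K : ℕ) : Type := EuclideanSpace ℝ (Fin a) × Fin K

/-- The examples `(x, y)` at which the score vector `g x` fails to have margin larger than `ε`:
`g x [y] ≤ max_{j ≠ y} g x [j] + ε`. (The supremum is a maximum when there are at least two classes.) -/
def marginFailure {a K : ℕ} (g : EuclideanSpace ℝ (Fin a) → EuclideanSpace ℝ (Fin K)) (ε : ℝ) :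
    Set (Example a K) :=
  {z | g z.1 z.2 ≤ (⨆ j : {j : Fin K // j ≠ z.2}, g z.1 j) + ε}

/-- The law of the pooled heterogeneous data: example `k` is drawn from the law `μ (c k)` of the client
`c k`, and the pooled law weights each client by its share of the `D` examples. -/
def pooledLaw {a K m D : ℕ} (μ : Fin m → Measure (Example a K)) (c : Fin D → Fin m) :
    Measure (Example a K) :=
  (D : ℝ≥0∞)⁻¹ • ∑ k, μ (c k)

/-- The expected margin loss `G_ε` of the predictor `g` under the law `ν`. -/
def marginLoss {a K : ℕ} (ν : Measure (Example a K))
    (g : EuclideanSpace ℝ (Fin a) → EuclideanSpace ℝ (Fin K)) (ε : ℝ) : ℝ :=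
  ν.real (marginFailure g ε)

/-- The empirical margin loss of the predictor `g` on the sample `S`: the fraction of the examples at
which the margin `ε` is not exceeded. -/
def empMarginLoss {a K D : ℕ} (S : Fin D → Example a K)
    (g : EuclideanSpace ℝ (Fin a) → EuclideanSpace ℝ (Fin K)) (ε : ℝ) : ℝ :=
  ({k : Fin D | S k ∈ marginFailure g ε}.ncard : ℝ) / D

end FedMargin

end

noncomputable section

namespace FedMargin

/-! The argument is a union bound over a countable family of predictors fixed before the data, with
prior weights `π z`. Hoeffding's inequality, which needs independence but not equal laws, controls
all of them at once with deviation `√((log (1 / π z) + log (1 / p)) / (2D))`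
(`exists_uniform_deviation`). It remains to place near each network a representative of not too
small weight: closeness `ε / 4` on the ball of radius `Ln` moves margins by at most `ε / 2`, so
margin `0` passes to `ε / 2` for the representative and to `ε` for the network
(`marginLoss_le_of_close`).

Dividing each layer by a bound for its spectral norm, and conjugating the activations by the
accumulated scale, leaves a single overall scale `(N + 1) ε`, comparable to `Ln` times the product
of these bounds (`exists_normalized_network`). The new activations are still 1-Lipschitz and vanish
at `0`, but depend on the weights, so they belong to the description of the network. With spectral
norms at most one, layer errors add up, and a precision `δ` of order `1 / (L (N + 1))` per layer
suffices. At this precision a normalised layer `W` acts as one of rank `k ≤ ‖W‖_F² / δ²`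
(`exists_isNearRank`), hence is described by at most `2dk` rounded numbers. Summing over layers,
`log (1 / π z)` is of order `d L² (N + 1)² log (dL) ∑ ‖w_l‖_F² / ‖w_l‖²` (`neg_log_priorWeight_le`);
inserting the size of `N + 1` produces `𝒱_L / ε²` (`sqrt_cost_le`). -/

/-! ### Linear layers and their norms -/

theorem linLayer_eq_toEuclideanLin {a b : ℕ} (A : Matrix (Fin b) (Fin a) ℝ)
    (x : EuclideanSpace ℝ (Fin a)) : linLayer A x = Matrix.toEuclideanLin A x := rfl

theorem linLayer_sub_left {a b : ℕ} (A B : Matrix (Fin b) (Fin a) ℝ)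
    (x : EuclideanSpace ℝ (Fin a)) : linLayer (A - B) x = linLayer A x - linLayer B x := by
  simp [linLayer_eq_toEuclideanLin]

theorem linLayer_smul_left {a b : ℕ} (t : ℝ) (A : Matrix (Fin b) (Fin a) ℝ)
    (x : EuclideanSpace ℝ (Fin a)) : linLayer (t • A) x = t • linLayer A x := by
  simp [linLayer_eq_toEuclideanLin]

theorem linLayer_smul_right {a b : ℕ} (t : ℝ) (A : Matrix (Fin b) (Fin a) ℝ)
    (x : EuclideanSpace ℝ (Fin a)) : linLayer A (t • x) = t • linLayer A x := by
  simp [linLayer_eq_toEuclideanLin]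

theorem linLayer_sub_right {a b : ℕ} (A : Matrix (Fin b) (Fin a) ℝ)
    (x y : EuclideanSpace ℝ (Fin a)) : linLayer A (x - y) = linLayer A x - linLayer A y := by
  simp [linLayer_eq_toEuclideanLin]

theorem continuous_linLayer {a b : ℕ} (A : Matrix (Fin b) (Fin a) ℝ) : Continuous (linLayer A) :=
  (Matrix.toEuclideanLin A).continuous_of_finiteDimensional

theorem specNorm_nonneg {a b : ℕ} (A : Matrix (Fin b) (Fin a) ℝ) : 0 ≤ specNorm A := by
  open scoped Matrix.Norms.L2Operator in
  exact norm_nonneg A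

theorem frobNorm_nonneg {a b : ℕ} (A : Matrix (Fin b) (Fin a) ℝ) : 0 ≤ frobNorm A := by
  open scoped Matrix.Norms.Frobenius in
  exact norm_nonneg A

theorem specNorm_pos {a b : ℕ} {A : Matrix (Fin b) (Fin a) ℝ} (hA : A ≠ 0) : 0 < specNorm A := by
  open scoped Matrix.Norms.L2Operator in
  exact norm_pos_iff.2 hA

theorem specNorm_add_le {a b : ℕ} (A B : Matrix (Fin b) (Fin a) ℝ) :
    specNorm (A + B) ≤ specNorm A + specNorm B := by
  open scoped Matrix.Norms.L2Operator in
  exact norm_add_le A B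

theorem frobNorm_add_le {a b : ℕ} (A B : Matrix (Fin b) (Fin a) ℝ) :
    frobNorm (A + B) ≤ frobNorm A + frobNorm B := by
  open scoped Matrix.Norms.Frobenius in
  exact norm_add_le A B

theorem specNorm_smul {a b : ℕ} (t : ℝ) (A : Matrix (Fin b) (Fin a) ℝ) :
    specNorm (t • A) = |t| * specNorm A := by
  open scoped Matrix.Norms.L2Operator in
  exact norm_smul t A

theorem frobNorm_smul {a b : ℕ} (t : ℝ) (A : Matrix (Fin b) (Fin a) ℝ) :
    frobNorm (t • A) = |t| * frobNorm A := by
  open scoped Matrix.Norms.Frobenius in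
  exact norm_smul t A

theorem norm_linLayer_le {a b : ℕ} (A : Matrix (Fin b) (Fin a) ℝ)
    (x : EuclideanSpace ℝ (Fin a)) : ‖linLayer A x‖ ≤ specNorm A * ‖x‖ := by
  open scoped Matrix.Norms.L2Operator in
  exact Matrix.l2_opNorm_mulVec A x

theorem specNorm_le_of_bound {a b : ℕ} {A : Matrix (Fin b) (Fin a) ℝ} {M : ℝ} (hM : 0 ≤ M)
    (h : ∀ x, ‖linLayer A x‖ ≤ M * ‖x‖) : specNorm A ≤ M := by
  unfold specNorm
  rw [Matrix.l2_opNorm_def]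
  exact ContinuousLinearMap.opNorm_le_bound _ hM h

theorem frobNorm_sq {a b : ℕ} (A : Matrix (Fin b) (Fin a) ℝ) :
    frobNorm A ^ 2 = ∑ i, ∑ j, A i j ^ 2 := by
  unfold frobNorm
  rw [Matrix.frobenius_norm_def, ← Real.sqrt_eq_rpow, Real.sq_sqrt (by positivity)]
  simp

theorem norm_linLayer_sq {a b : ℕ} (A : Matrix (Fin b) (Fin a) ℝ) (x : EuclideanSpace ℝ (Fin a)) :
    ‖linLayer A x‖ ^ 2 = ∑ i, (inner ℝ x (WithLp.toLp 2 (A i))) ^ 2 := by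
  rw [EuclideanSpace.norm_sq_eq]
  refine Finset.sum_congr rfl fun i _ => ?_
  rw [Real.norm_eq_abs, sq_abs]
  simp [linLayer, Matrix.mulVec, dotProduct, PiLp.inner_apply]

/-- Bessel's inequality for each row of `A`, summed over the rows. -/
theorem sum_norm_linLayer_sq_le {a b k : ℕ} (A : Matrix (Fin b) (Fin a) ℝ)
    {u : Fin k → EuclideanSpace ℝ (Fin a)} (hu : Orthonormal ℝ u) :
    ∑ i, ‖linLayer A (u i)‖ ^ 2 ≤ frobNorm A ^ 2 := by
  simp_rw [norm_linLayer_sq]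
  rw [Finset.sum_comm, frobNorm_sq]
  refine Finset.sum_le_sum fun r _ => ?_
  have h := hu.sum_inner_products_le (x := WithLp.toLp 2 (A r)) (s := Finset.univ)
  rw [EuclideanSpace.norm_sq_eq] at h
  simpa using h

theorem specNorm_le_frobNorm {a b : ℕ} (A : Matrix (Fin b) (Fin a) ℝ) :
    specNorm A ≤ frobNorm A := by
  refine specNorm_le_of_bound (frobNorm_nonneg A) fun x => ?_
  refine le_of_sq_le_sq ?_ (by have := frobNorm_nonneg A; positivity)
  rw [norm_linLayer_sq, mul_pow, frobNorm_sq, Finset.sum_mul]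
  refine Finset.sum_le_sum fun i _ => ?_
  have h := abs_real_inner_le_norm x (WithLp.toLp 2 (A i))
  have h2 : ‖(WithLp.toLp 2 (A i) : EuclideanSpace ℝ (Fin a))‖ ^ 2 = ∑ j, A i j ^ 2 := by
    rw [EuclideanSpace.norm_sq_eq]; simp
  rw [← h2, ← sq_abs, ← mul_pow, mul_comm]
  exact pow_le_pow_left₀ (abs_nonneg _) h 2

/-! ### Low rank approximation of a layer -/

/-- `A` is within `δ`, in the spectral norm, of its composition with a combination of `k` rank-one
maps `x ↦ ⟪u i, x⟫ u i`. -/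
def IsNearRank {a b : ℕ} (k : ℕ) (δ : ℝ) (A : Matrix (Fin b) (Fin a) ℝ) : Prop :=
  ∃ u : Fin k → EuclideanSpace ℝ (Fin a), (∀ i, ‖u i‖ ≤ 1) ∧
    ∀ x, ‖linLayer A x - ∑ i, inner ℝ (u i) x • linLayer A (u i)‖ ≤ δ * ‖x‖

/-- Take an orthonormal system of vectors stretched by more than `δ` that cannot be enlarged. Its
size is limited by the Frobenius norm, and on its orthogonal complement `A` is bounded by `δ`, since
otherwise a normalised vector there could be added. -/
theorem exists_isNearRank {a b : ℕ} (A : Matrix (Fin b) (Fin a) ℝ) {δ : ℝ} (hδ : 0 < δ) :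
    ∃ k : ℕ, k ≤ a ∧ k * δ ^ 2 ≤ frobNorm A ^ 2 ∧ IsNearRank k δ A := by
  classical
  let P : ℕ → Prop := fun k => ∃ u : Fin k → EuclideanSpace ℝ (Fin a),
    Orthonormal ℝ u ∧ ∀ i, δ < ‖linLayer A (u i)‖
  have hP0 : P 0 := ⟨fun i => i.elim0, ⟨fun i => i.elim0, fun i => i.elim0⟩, fun i => i.elim0⟩
  have hPa : ∀ k, P k → k ≤ a := by
    rintro k ⟨u, hu, -⟩
    simpa using hu.linearIndependent.fintype_card_le_finrank
  obtain ⟨k, hk, hk1⟩ : ∃ k, P k ∧ ¬ P (k + 1) := by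
    by_contra! h
    have : ∀ k, P k := fun k => Nat.rec hP0 (fun k hk => h k hk) k
    exact absurd (hPa _ (this (a + 1))) (by lia)
  refine ⟨k, hPa k hk, ?_⟩
  obtain ⟨u, hu, hδu⟩ := hk
  constructor
  · refine le_trans ?_ (sum_norm_linLayer_sq_le A hu)
    have : ∑ _i : Fin k, δ ^ 2 ≤ ∑ i, ‖linLayer A (u i)‖ ^ 2 :=
      Finset.sum_le_sum fun i _ => pow_le_pow_left₀ hδ.le (hδu i).le 2
    simpa using this
  have hperp : ∀ v, (∀ i, inner ℝ v (u i) = 0) → ‖linLayer A v‖ ≤ δ * ‖v‖ := by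
    intro v hv
    by_contra! hlt
    have hv0 : 0 < ‖v‖ := by
      rw [norm_pos_iff]
      rintro rfl
      simp [linLayer_eq_toEuclideanLin] at hlt
    refine hk1 ⟨Matrix.vecCons (‖v‖⁻¹ • v) u, ?_, ?_⟩
    · rw [orthonormal_vecCons_iff]
      refine ⟨?_, fun i => ?_, hu⟩
      · rw [norm_smul, norm_inv, norm_norm, inv_mul_cancel₀ hv0.ne']
      · rw [inner_smul_left, hv i, mul_zero]
    · intro i
      refine Fin.cases ?_ (fun j => ?_) i
      · rw [Matrix.cons_val_zero, linLayer_smul_right, norm_smul, norm_inv, norm_norm,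
          inv_mul_eq_div, lt_div_iff₀ hv0]
        exact hlt
      · simpa using hδu j
  refine ⟨u, fun i => (hu.1 i).le, fun x => ?_⟩
  set v := x - ∑ i, inner ℝ (u i) x • u i with hv
  have horth : ∀ i, inner ℝ v (u i) = 0 := by
    intro i
    rw [hv, inner_sub_left, sum_inner]
    simp [inner_smul_left, orthonormal_iff_ite.1 hu, real_inner_comm]
  have hAv : linLayer A x - ∑ i, inner ℝ (u i) x • linLayer A (u i) = linLayer A v := by
    simp [hv, linLayer_eq_toEuclideanLin]
  rw [hAv]
  refine (hperp v horth).trans (mul_le_mul_of_nonneg_left ?_ hδ.le)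
  have h1 : inner ℝ v (x - v) = 0 := by
    rw [hv, sub_sub_cancel, ← hv, inner_sum]
    simp [inner_smul_right, horth]
  rw [inner_sub_right, real_inner_self_eq_norm_sq, sub_eq_zero] at h1
  have h2 := real_inner_le_norm v x
  by_contra! h3
  nlinarith [norm_nonneg x, norm_nonneg v]

/-! ### Rounding of matrices and activations -/

/-- The number of the cell of length `1 / q` containing a point of `[-1, 1]`. -/
def cell (q : ℕ) (x : ℝ) : Fin (2 * q + 1) := Fin.ofNat (2 * q + 1) ⌊(x + 1) * q⌋₊

theorem abs_sub_le_of_cell_eq {q : ℕ} (hq : 0 < q) {x y : ℝ} (hx : |x| ≤ 1) (hy : |y| ≤ 1)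
    (h : cell q x = cell q y) : |x - y| ≤ 1 / q := by
  have hq' : (0 : ℝ) < q := by exact_mod_cast hq
  have key : ∀ z : ℝ, |z| ≤ 1 → ((cell q z : ℕ) : ℝ) ≤ (z + 1) * q ∧
      (z + 1) * q < (cell q z : ℕ) + 1 := by
    intro z hz
    obtain ⟨h1, h2⟩ := abs_le.1 hz
    have h0 : 0 ≤ (z + 1) * q := mul_nonneg (by linarith) hq'.le
    -- The endpoint `z = 1` falls into cell `2 * q`, so the reduction modulo `2 * q + 1` in `cell`
    -- has no effect on `[-1, 1]`.
    have hlt : ⌊(z + 1) * q⌋₊ < 2 * q + 1 := by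
      rw [Nat.floor_lt h0]
      push_cast
      nlinarith
    have : (cell q z : ℕ) = ⌊(z + 1) * q⌋₊ := by
      simp [cell, Fin.ofNat, Nat.mod_eq_of_lt hlt]
    rw [this]
    exact ⟨Nat.floor_le h0, Nat.lt_floor_add_one _⟩
  obtain ⟨hx1, hx2⟩ := key x hx
  obtain ⟨hy1, hy2⟩ := key y hy
  rw [h] at hx1 hx2
  rw [le_div_iff₀ hq', ← abs_of_pos hq', ← abs_mul, abs_le]
  constructor <;> nlinarith

/-- The cruder factor `a` in place of `√a` is harmless: it enters the matrix cost only through a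
logarithm, and the activation cost through the factor `d` already present in the bound. -/
theorem norm_le_card_mul {a : ℕ} {x : EuclideanSpace ℝ (Fin a)} {r : ℝ}
    (h : ∀ i, |x i| ≤ r) : ‖x‖ ≤ a * r := by
  have hx : x = ∑ i, EuclideanSpace.single i (x i) := by
    ext j
    simp [Pi.single_apply]
  rw [hx]
  refine (norm_sum_le _ _).trans ?_
  have : ∑ i, ‖EuclideanSpace.single i (x i)‖ ≤ ∑ _i : Fin a, r :=
    Finset.sum_le_sum fun i _ => by simpa using h i
  simpa using this

theorem abs_apply_le_norm {a : ℕ} (x : EuclideanSpace ℝ (Fin a)) (i : Fin a) : |x i| ≤ ‖x‖ := by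
  simpa using PiLp.norm_apply_le x i

theorem norm_sub_le_of_cell_eq {q a : ℕ} (hq : 0 < q) {x y : EuclideanSpace ℝ (Fin a)}
    (hx : ‖x‖ ≤ 1) (hy : ‖y‖ ≤ 1) (h : ∀ i, cell q (x i) = cell q (y i)) :
    ‖x - y‖ ≤ a / q := by
  have := norm_le_card_mul (x := x - y) (r := 1 / q) fun i =>
    abs_sub_le_of_cell_eq hq ((abs_apply_le_norm x i).trans hx) ((abs_apply_le_norm y i).trans hy)
      (h i)
  rwa [mul_one_div] at this

open Classical in
/-- A finite description of a nearly low rank matrix: the rounded entries of the vectors `u i` and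
of their images. -/
def matrixCode {a b : ℕ} (k q : ℕ) (δ : ℝ) (A : Matrix (Fin b) (Fin a) ℝ) :
    Fin k → (Fin a → Fin (2 * q + 1)) × (Fin b → Fin (2 * q + 1)) :=
  if h : IsNearRank k δ A then
    fun i => (fun j => cell q (h.choose i j), fun j => cell q (linLayer A (h.choose i) j))
  else fun _ => (0, 0)

/-- Truncating both matrices costs `2 * δ`. Equal codes put the vectors within `a / q` and their
images within `b / q`, so each of the `k` rank-one terms moves by at most `(a + b) / q`. -/
theorem specNorm_sub_le_of_matrixCode_eq {a b k q : ℕ} {δ : ℝ} (hq : 0 < q) (hδ : 0 ≤ δ)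
    {A B : Matrix (Fin b) (Fin a) ℝ} (hA : IsNearRank k δ A) (hB : IsNearRank k δ B)
    (hA1 : specNorm A ≤ 1) (hB1 : specNorm B ≤ 1) (h : matrixCode k q δ A = matrixCode k q δ B) :
    specNorm (A - B) ≤ 2 * δ + k * ((a + b) / q) := by
  rw [matrixCode, matrixCode, dif_pos hA, dif_pos hB] at h
  obtain ⟨hu1, hu2⟩ := hA.choose_spec
  obtain ⟨hv1, hv2⟩ := hB.choose_spec
  set u := hA.choose
  set v := hB.choose
  have hlin : ∀ {A : Matrix (Fin b) (Fin a) ℝ} {x}, specNorm A ≤ 1 → ‖x‖ ≤ 1 →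
      ‖linLayer A x‖ ≤ 1 := fun {A x} hA hx =>
    (norm_linLayer_le A x).trans (mul_le_one₀ hA (norm_nonneg _) hx)
  have hq' : (0 : ℝ) < q := by exact_mod_cast hq
  refine specNorm_le_of_bound (by positivity) fun x => ?_
  have hsum : ‖∑ i, inner ℝ (u i) x • linLayer A (u i) - ∑ i, inner ℝ (v i) x • linLayer B (v i)‖ ≤
      k * ((a + b) / q) * ‖x‖ := by
    rw [← Finset.sum_sub_distrib]
    refine (norm_sum_le _ _).trans ?_
    have : ∀ i : Fin k, ‖inner ℝ (u i) x • linLayer A (u i) - inner ℝ (v i) x • linLayer B (v i)‖ ≤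
        (a + b) / q * ‖x‖ := by
      intro i
      have hi := congrFun h i
      simp only [Prod.mk.injEq] at hi
      have h1 := norm_sub_le_of_cell_eq hq (hu1 i) (hv1 i) (congrFun hi.1)
      have h2 := norm_sub_le_of_cell_eq hq (hlin hA1 (hu1 i)) (hlin hB1 (hv1 i)) (congrFun hi.2)
      have e : inner ℝ (u i) x • linLayer A (u i) - inner ℝ (v i) x • linLayer B (v i) =
          inner ℝ (u i - v i) x • linLayer A (u i) +
            inner ℝ (v i) x • (linLayer A (u i) - linLayer B (v i)) := by
        rw [inner_sub_left]
        module
      rw [e]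
      refine (norm_add_le _ _).trans ?_
      rw [norm_smul, norm_smul, add_div, add_mul]
      refine add_le_add ?_ ?_
      · calc _ ≤ (‖u i - v i‖ * ‖x‖) * 1 := mul_le_mul (norm_inner_le_norm _ _)
              (hlin hA1 (hu1 i)) (norm_nonneg _) (by positivity)
          _ ≤ _ := by
            rw [mul_one]
            exact mul_le_mul_of_nonneg_right h1 (norm_nonneg _)
      · have h3 : ‖(inner ℝ (v i) x : ℝ)‖ ≤ ‖x‖ := (norm_inner_le_norm _ _).trans
          (mul_le_of_le_one_left (norm_nonneg _) (hv1 i))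
        rw [mul_comm]
        exact mul_le_mul h2 h3 (norm_nonneg _) (by positivity)
    refine (Finset.sum_le_sum fun i _ => this i).trans ?_
    simp [mul_assoc]
  have e : linLayer (A - B) x = (linLayer A x - ∑ i, inner ℝ (u i) x • linLayer A (u i)) -
      (linLayer B x - ∑ i, inner ℝ (v i) x • linLayer B (v i)) +
      (∑ i, inner ℝ (u i) x • linLayer A (u i) - ∑ i, inner ℝ (v i) x • linLayer B (v i)) := by
    rw [linLayer_sub_left]
    abel
  rw [e]
  refine (norm_add_le _ _).trans ?_
  have h4 := norm_sub_le (linLayer A x - ∑ i, inner ℝ (u i) x • linLayer A (u i))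
    (linLayer B x - ∑ i, inner ℝ (v i) x • linLayer B (v i))
  have := hu2 x
  have := hv2 x
  linarith

/-- The rounded values of a function on the grid of step `1 / M` in `[-1, 1]`. -/
def actCode (M : ℕ) (g : ℝ → ℝ) : Fin (2 * M + 1) → Fin (2 * M + 1) :=
  fun i => cell M (g ((i : ℕ) / M - 1))

/-- Pass from `x` to the grid point `y` just below it, compare the rounded values there, and return
to `x`: each of the three moves costs `1 / M`. -/
theorem abs_sub_le_of_actCode_eq {M : ℕ} (hM : 0 < M) {f g : ℝ → ℝ} (hf : LipschitzWith 1 f)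
    (hg : LipschitzWith 1 g) (hf0 : f 0 = 0) (hg0 : g 0 = 0) (h : actCode M f = actCode M g)
    {x : ℝ} (hx : |x| ≤ 1) : |f x - g x| ≤ 3 / M := by
  have hM' : (0 : ℝ) < M := by exact_mod_cast hM
  obtain ⟨hx1, hx2⟩ := abs_le.1 hx
  have h0 : 0 ≤ (x + 1) * M := mul_nonneg (by linarith) hM'.le
  have hlt : ⌊(x + 1) * M⌋₊ < 2 * M + 1 := by
    rw [Nat.floor_lt h0]
    push_cast
    nlinarith
  have hi := congrFun h ⟨⌊(x + 1) * M⌋₊, hlt⟩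
  simp only [actCode] at hi
  set y : ℝ := (⌊(x + 1) * M⌋₊ : ℝ) / M - 1 with hy
  have hfl := Nat.floor_le h0
  have hfl2 := Nat.lt_floor_add_one ((x + 1) * M)
  have hyx : y ≤ x := by
    rw [hy, sub_le_iff_le_add, div_le_iff₀ hM']
    exact hfl
  have hxy : x - y ≤ 1 / M := by
    have : x + 1 ≤ ((⌊(x + 1) * M⌋₊ : ℝ) + 1) / M := by
      rw [le_div_iff₀ hM']; exact hfl2.le
    rw [add_div] at this
    rw [hy]
    linarith
  have hy1 : |y| ≤ 1 := by
    rw [abs_le]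
    refine ⟨?_, hyx.trans hx2⟩
    rw [hy]
    have : (0 : ℝ) ≤ (⌊(x + 1) * M⌋₊ : ℝ) / M := by positivity
    linarith
  have hd : |x - y| ≤ 1 / M := by rwa [abs_of_nonneg (by linarith)]
  have bound : ∀ {k : ℝ → ℝ}, LipschitzWith 1 k → ∀ s t, |k s - k t| ≤ |s - t| := by
    intro k hk s t
    simpa [Real.dist_eq] using hk.dist_le_mul s t
  have b0 : ∀ {k : ℝ → ℝ}, LipschitzWith 1 k → k 0 = 0 → |k y| ≤ 1 := by
    intro k hk hk0
    have := bound hk y 0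
    rw [hk0] at this
    simpa using this.trans (by simpa using hy1)
  have h1 := abs_sub_le_of_cell_eq hM (b0 hf hf0) (b0 hg hg0) hi
  have h2 := bound hf x y
  have h3 := bound hg y x
  rw [abs_sub_comm y x] at h3
  have e : f x - g x = (f x - f y) + (f y - g y) + (g y - g x) := by ring
  rw [e]
  refine (abs_add_three _ _ _).trans ?_
  have : (3 : ℝ) / M = 1 / M + 1 / M + 1 / M := by ring
  linarith

/-! ### Networks: size, rescaling and perturbation -/

theorem norm_actLayer_sub_le {a : ℕ} {g : ℝ → ℝ} (hg : LipschitzWith 1 g)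
    (x y : EuclideanSpace ℝ (Fin a)) : ‖actLayer g x - actLayer g y‖ ≤ ‖x - y‖ := by
  rw [EuclideanSpace.norm_eq, EuclideanSpace.norm_eq]
  refine Real.sqrt_le_sqrt (Finset.sum_le_sum fun i _ => pow_le_pow_left₀ (norm_nonneg _) ?_ 2)
  simpa [actLayer, Real.dist_eq] using hg.dist_le_mul (x i) (y i)

theorem norm_actLayer_le {a : ℕ} {g : ℝ → ℝ} (hg : LipschitzWith 1 g) (hg0 : g 0 = 0)
    (x : EuclideanSpace ℝ (Fin a)) : ‖actLayer g x‖ ≤ ‖x‖ := by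
  have h0 : actLayer g (0 : EuclideanSpace ℝ (Fin a)) = 0 := by
    ext i
    simp [actLayer, hg0]
  simpa [h0] using norm_actLayer_sub_le hg x 0

theorem continuous_actLayer {a : ℕ} {g : ℝ → ℝ} (hg : LipschitzWith 1 g) :
    Continuous (actLayer (a := a) g) := by
  have : LipschitzWith 1 (actLayer (a := a) g) :=
    LipschitzWith.of_dist_le_mul fun x y => by
      simpa [dist_eq_norm] using norm_actLayer_sub_le hg x y
  exact this.continuous

variable {n : ℕ → ℕ}

theorem continuous_network {φ : ℕ → ℝ → ℝ} (hφ : ∀ l, LipschitzWith 1 (φ l)) (w : Weights n) :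
    ∀ l, Continuous (network φ w l)
  | 0 => continuous_id
  | 1 => continuous_linLayer (w 0)
  | l + 2 => (continuous_linLayer (w (l + 1))).comp
      ((continuous_actLayer (hφ l)).comp (continuous_network hφ w (l + 1)))

theorem norm_network_le {φ : ℕ → ℝ → ℝ} (hφ : ∀ l, LipschitzWith 1 (φ l)) (hφ0 : ∀ l, φ l 0 = 0)
    {w : Weights n} {t : ℕ → ℝ} (x : EuclideanSpace ℝ (Fin (n 0))) :
    ∀ l, (∀ i < l, specNorm (w i) ≤ t i) → ‖network φ w l x‖ ≤ (∏ i ∈ Finset.range l, t i) * ‖x‖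
  | 0, _ => by simp [network]
  | 1, h => by
      simpa [network] using (norm_linLayer_le (w 0) x).trans
        (mul_le_mul_of_nonneg_right (h 0 one_pos) (norm_nonneg _))
  | l + 2, h => by
      have ih := norm_network_le hφ hφ0 x (l + 1) fun i hi => h i (by lia)
      have h1 := norm_linLayer_le (w (l + 1)) (actLayer (φ l) (network φ w (l + 1) x))
      have h2 := (norm_actLayer_le (hφ l) (hφ0 l) (network φ w (l + 1) x)).trans ih
      rw [Finset.prod_range_succ, mul_comm _ (t (l + 1)), mul_assoc]
      exact h1.trans (mul_le_mul (h (l + 1) (by lia)) h2 (norm_nonneg _)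
        ((specNorm_nonneg _).trans (h (l + 1) (by lia))))

/-- Rescaling all layers of a network, at the cost of rescaling its activations. -/
theorem network_rescale (φ : ℕ → ℝ → ℝ) (v : Weights n) {ρ : ℝ} (hρ : ρ ≠ 0) {t : ℕ → ℝ}
    (x : EuclideanSpace ℝ (Fin (n 0))) :
    ∀ l, (∀ i < l, t i ≠ 0) → network φ v l x =
      (ρ * ∏ i ∈ Finset.range l, t i) •
        network (fun j u => φ j ((ρ * ∏ i ∈ Finset.range (j + 1), t i) * u) /
            (ρ * ∏ i ∈ Finset.range (j + 1), t i))
          (fun i => (t i)⁻¹ • v i) l (ρ⁻¹ • x)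
  | 0, _ => by simp [network, smul_smul, hρ]
  | 1, h => by
      simp only [network, Finset.range_one, Finset.prod_singleton, linLayer_smul_left,
        linLayer_smul_right, smul_smul]
      have := h 0 one_pos
      rw [show ρ * t 0 * (ρ⁻¹ * (t 0)⁻¹) = 1 by field_simp, one_smul]
  | l + 2, h => by
      have ih := network_rescale φ v hρ x (l + 1) fun i hi => h i (by lia)
      have ha : ρ * ∏ i ∈ Finset.range (l + 1), t i ≠ 0 :=
        mul_ne_zero hρ (Finset.prod_ne_zero_iff.2 fun i hi =>
          h i (by have := Finset.mem_range.1 hi; lia))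
      simp only [network]
      rw [ih, Finset.prod_range_succ _ (l + 1), linLayer_smul_left, smul_smul]
      have ht := h (l + 1) (by lia)
      rw [show ρ * ((∏ i ∈ Finset.range (l + 1), t i) * t (l + 1)) * (t (l + 1))⁻¹ =
        ρ * ∏ i ∈ Finset.range (l + 1), t i by field_simp, ← linLayer_smul_right]
      congr 1
      ext i
      simp [actLayer, mul_div_cancel₀ _ ha]

theorem lipschitzWith_rescale {g : ℝ → ℝ} (hg : LipschitzWith 1 g) (a : ℝ) :
    LipschitzWith 1 fun u => g (a * u) / a := by
  refine LipschitzWith.of_dist_le_mul fun x y => ?_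
  rcases eq_or_ne a 0 with rfl | ha
  · simp
  have h := hg.dist_le_mul (a * x) (a * y)
  rw [Real.dist_eq, Real.dist_eq, ← mul_sub, abs_mul] at h
  rw [Real.dist_eq, Real.dist_eq, ← sub_div, abs_div, div_le_iff₀ (abs_pos.2 ha)]
  calc _ ≤ _ := h
    _ = _ := by ring

/-- Norms at most one keep every signal in the unit ball, where the activations are compared, and
prevent the amplification of earlier errors. Each layer therefore adds at most `δ` from its matrix
and `d * η` from its activation. -/
theorem norm_network_sub_le {φ ψ : ℕ → ℝ → ℝ} (hφ : ∀ l, LipschitzWith 1 (φ l))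
    (hφ0 : ∀ l, φ l 0 = 0) (hψ : ∀ l, LipschitzWith 1 (ψ l)) (hψ0 : ∀ l, ψ l 0 = 0) {d : ℕ}
    {v w : Weights n} {δ η : ℝ} (hη : 0 ≤ η)
    {x : EuclideanSpace ℝ (Fin (n 0))} (hx : ‖x‖ ≤ 1) :
    ∀ l, (∀ i ≤ l, n i ≤ d) → (∀ i < l, specNorm (v i) ≤ 1) → (∀ i < l, specNorm (w i) ≤ 1) →
      (∀ i < l, specNorm (v i - w i) ≤ δ) → (∀ i < l, ∀ u, |u| ≤ 1 → |φ i u - ψ i u| ≤ η) →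
      ‖network φ v l x - network ψ w l x‖ ≤ l * (δ + d * η)
  | 0, _, _, _, _, _ => by simp [network]
  | 1, _, _, _, hδ, _ => by
      have h1 := hδ 0 one_pos
      have h2 := norm_linLayer_le (v 0 - w 0) x
      rw [linLayer_sub_left] at h2
      simp only [network, Nat.cast_one, one_mul]
      have h3 : specNorm (v 0 - w 0) * ‖x‖ ≤ δ * 1 :=
        mul_le_mul h1 hx (norm_nonneg _) ((specNorm_nonneg _).trans h1)
      have : 0 ≤ (d : ℝ) * η := by positivity
      linarith
  | l + 2, hd, hv, hw, hδ, hg => by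
      have ih := norm_network_sub_le hφ hφ0 hψ hψ0 (d := d) (v := v) (w := w) (δ := δ) hη hx (l + 1)
        (fun i hi => hd i (by lia)) (fun i hi => hv i (by lia)) (fun i hi => hw i (by lia))
        (fun i hi => hδ i (by lia)) (fun i hi => hg i (by lia))
      have hy : ‖network φ v (l + 1) x‖ ≤ 1 := by
        have := norm_network_le hφ hφ0 (t := fun _ => 1) x (l + 1) fun i hi => hv i (by lia)
        simpa using this.trans (by simpa using hx)
      simp only [network]
      set y := network φ v (l + 1) x
      set z := network ψ w (l + 1) x
      have e : linLayer (v (l + 1)) (actLayer (φ l) y) - linLayer (w (l + 1)) (actLayer (ψ l) z) =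
          linLayer (v (l + 1) - w (l + 1)) (actLayer (φ l) y) +
          linLayer (w (l + 1)) (actLayer (φ l) y - actLayer (ψ l) y) +
          linLayer (w (l + 1)) (actLayer (ψ l) y - actLayer (ψ l) z) := by
        rw [linLayer_sub_left, linLayer_sub_right, linLayer_sub_right]
        abel
      have h1 : ‖linLayer (v (l + 1) - w (l + 1)) (actLayer (φ l) y)‖ ≤ δ := by
        have h := hδ (l + 1) (by lia)
        calc _ ≤ _ := norm_linLayer_le _ _
          _ ≤ δ * 1 := mul_le_mul h ((norm_actLayer_le (hφ l) (hφ0 l) y).trans hy) (norm_nonneg _)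
              ((specNorm_nonneg _).trans h)
          _ = δ := mul_one δ
      have hw1 : ∀ u, ‖linLayer (w (l + 1)) u‖ ≤ ‖u‖ := fun u =>
        (norm_linLayer_le _ u).trans
          (mul_le_of_le_one_left (norm_nonneg _) (hw (l + 1) (by lia)))
      have h2 : ‖actLayer (φ l) y - actLayer (ψ l) y‖ ≤ d * η := by
        refine (norm_le_card_mul (r := η) fun i => ?_).trans
          (mul_le_mul_of_nonneg_right (by exact_mod_cast hd (l + 1) (by lia)) hη)
        exact hg l (by lia) _ ((abs_apply_le_norm y i).trans hy)
      have h3 := norm_actLayer_sub_le (hψ l) y z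
      rw [e]
      refine (norm_add₃_le).trans ?_
      have h4 := hw1 (actLayer (φ l) y - actLayer (ψ l) y)
      have h5 := hw1 (actLayer (ψ l) y - actLayer (ψ l) z)
      push_cast at ih ⊢
      linarith

/-! ### Descriptions of networks -/

/-- The finite descriptions of networks with `L` layers whose layer `l + 1` is nearly of rank
`k l`. -/
abbrev NetCode (n : ℕ → ℕ) (L : ℕ) (k : Fin L → ℕ) (q M : ℕ) : Type :=
  (l : Fin L) → (Fin (k l) → (Fin (n l) → Fin (2 * q + 1)) × (Fin (n (l + 1)) → Fin (2 * q + 1))) ×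
    (Fin (2 * M + 1) → Fin (2 * M + 1))

/-- The description of a network with activations `g` and weights `w`. -/
def netCode (L : ℕ) (k : Fin L → ℕ) (q M : ℕ) (δ : ℝ) (g : ℕ → ℝ → ℝ) (w : Weights n) :
    NetCode n L k q M :=
  fun l => (matrixCode (k l) q δ (w l), actCode M (g l))

/-- The networks whose weights have spectral norm at most one and are nearly of rank `k`. -/
structure IsCodable (L : ℕ) (k : Fin L → ℕ) (δ : ℝ) (g : ℕ → ℝ → ℝ) (w : Weights n) : Prop where
  lipschitz : ∀ l, LipschitzWith 1 (g l)
  map_zero : ∀ l, g l 0 = 0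
  specNorm_le : ∀ l < L, specNorm (w l) ≤ 1
  isNearRank : ∀ l : Fin L, IsNearRank (k l) δ (w l)

theorem norm_network_sub_le_of_netCode_eq {L d q M : ℕ} {k : Fin L → ℕ} {δ : ℝ} (hδ : 0 ≤ δ)
    (hq : 0 < q) (hM : 0 < M) (hd : ∀ l ≤ L, n l ≤ d) (hk : ∀ l, k l ≤ d)
    {g h : ℕ → ℝ → ℝ} {v w : Weights n} (hv : IsCodable L k δ g v) (hw : IsCodable L k δ h w)
    (e : netCode L k q M δ g v = netCode L k q M δ h w)
    {x : EuclideanSpace ℝ (Fin (n 0))} (hx : ‖x‖ ≤ 1) :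
    ‖network g v L x - network h w L x‖ ≤
      L * (2 * δ + d * ((d + d) / q) + d * (3 / M)) := by
  refine norm_network_sub_le hv.lipschitz hv.map_zero hw.lipschitz hw.map_zero (by positivity) hx
    L hd hv.specNorm_le hw.specNorm_le (fun i hi => ?_) fun i hi u hu => ?_
  · have ei := congrFun e ⟨i, hi⟩
    simp only [netCode, Prod.mk.injEq] at ei
    refine (specNorm_sub_le_of_matrixCode_eq hq hδ (hv.isNearRank ⟨i, hi⟩) (hw.isNearRank ⟨i, hi⟩)
      (hv.specNorm_le i hi) (hw.specNorm_le i hi) ei.1).trans ?_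
    have h1 : (n i : ℝ) ≤ d := by exact_mod_cast hd i hi.le
    have h2 : (n (i + 1) : ℝ) ≤ d := by exact_mod_cast hd (i + 1) hi
    have h3 : (k ⟨i, hi⟩ : ℝ) ≤ d := by exact_mod_cast hk ⟨i, hi⟩
    gcongr
  · have ei := congrFun e ⟨i, hi⟩
    simp only [netCode, Prod.mk.injEq] at ei
    exact abs_sub_le_of_actCode_eq hM (hv.lipschitz i) (hw.lipschitz i) (hv.map_zero i)
      (hw.map_zero i) ei.2 hu

theorem card_netCode_le {L d q M : ℕ} {k : Fin L → ℕ} (hd : ∀ l ≤ L, n l ≤ d) :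
    Fintype.card (NetCode n L k q M) ≤
      (2 * q + 1) ^ (2 * d * ∑ l, k l) * (2 * M + 1) ^ ((2 * M + 1) * L) := by
  have h1 : ∀ l : Fin L, (2 * q + 1) ^ (n (l + 1)) ≤ (2 * q + 1) ^ d := fun l =>
    Nat.pow_le_pow_right (by lia) (hd _ l.2)
  have h0 : ∀ l : Fin L, (2 * q + 1) ^ (n l) ≤ (2 * q + 1) ^ d := fun l =>
    Nat.pow_le_pow_right (by lia) (hd _ l.2.le)
  rw [Fintype.card_pi]
  calc _ ≤ ∏ l : Fin L, (2 * q + 1) ^ (2 * d * k l) * (2 * M + 1) ^ (2 * M + 1) := by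
        refine Finset.prod_le_prod' fun l _ => ?_
        simp only [Fintype.card_prod, Fintype.card_fun, Fintype.card_fin]
        refine Nat.mul_le_mul_right _ ?_
        rw [pow_mul]
        refine Nat.pow_le_pow_left ?_ _
        rw [two_mul d, pow_add]
        exact Nat.mul_le_mul (h0 l) (h1 l)
    _ = _ := by
        rw [Finset.prod_mul_distrib, Finset.prod_pow_eq_pow_sum, ← Finset.mul_sum]
        simp [pow_mul]

/-! ### Concentration for independent examples with different laws -/

theorem sum_indicator_eq_ncard {α : Type*} {D : ℕ} (A : Set α) (S : Fin D → α) :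
    ∑ k, A.indicator (1 : α → ℝ) (S k) = ({k | S k ∈ A}.ncard : ℝ) := by
  classical
  rw [Set.ncard_eq_toFinset_card']
  simp [Set.indicator_apply, Finset.sum_boole]

section Concentration

variable {α : Type*} [MeasurableSpace α] {D : ℕ} (ν : Fin D → Measure α)
  [∀ k, IsProbabilityMeasure (ν k)]

theorem measure_pi_deviation_le (hD : 0 < D) {A : Set α} (hA : MeasurableSet A) {t : ℝ}
    (ht : 0 ≤ t) :
    (Measure.pi ν).real {S | t ≤ ∑ k, ((ν k).real A - A.indicator 1 (S k))} ≤
      Real.exp (-(2 * t ^ 2 / D)) := by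
  have hm : ∀ k, AEMeasurable (fun x : α => (ν k).real A - A.indicator (1 : α → ℝ) x) (ν k) :=
    fun k => (measurable_const.sub (measurable_one.indicator hA)).aemeasurable
  have hind : ProbabilityTheory.iIndepFun
      (fun k (S : Fin D → α) => (ν k).real A - A.indicator (1 : α → ℝ) (S k)) (Measure.pi ν) :=
    ProbabilityTheory.iIndepFun_pi
      (X := fun k (x : α) => (ν k).real A - A.indicator (1 : α → ℝ) x) hm
  -- By Hoeffding's lemma the variance proxy is the squared half-length of the range `[-1, 0]` of
  -- the negated indicator.
  have hsub : ∀ k ∈ Finset.univ, ProbabilityTheory.HasSubgaussianMGF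
      (fun S : Fin D → α => (ν k).real A - A.indicator (1 : α → ℝ) (S k)) ((1 / 2) ^ 2)
      (Measure.pi ν) := by
    intro k _
    have hX : Measurable fun S : Fin D → α => -A.indicator (1 : α → ℝ) (S k) :=
      ((measurable_one.indicator hA).comp (measurable_pi_apply k)).neg
    have h := ProbabilityTheory.hasSubgaussianMGF_of_mem_Icc (μ := Measure.pi ν) (a := -1) (b := 0)
      hX.aemeasurable (Filter.Eventually.of_forall fun S => by
        by_cases hS : S k ∈ A <;> simp [hS])
    have hint : ∫ S, -A.indicator (1 : α → ℝ) (S k) ∂(Measure.pi ν) = -(ν k).real A := by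
      rw [integral_neg, integral_comp_eval (i := k) (μ := ν)
        (measurable_one.indicator hA).aestronglyMeasurable, integral_indicator_one hA]
    rw [hint] at h
    convert h using 1
    · ext S
      ring
    · simp
  have := ProbabilityTheory.HasSubgaussianMGF.measure_sum_ge_le_of_iIndepFun hind hsub ht
  refine this.trans_eq ?_
  congr 1
  have : (D : ℝ) ≠ 0 := by exact_mod_cast hD.ne'
  simp
  field_simp

/-- Hoeffding's inequality for countably many events, with prior weights. -/
theorem exists_uniform_deviation (hD : 0 < D) {ι : Type*} [Countable ι] {A : ι → Set α}
    (hA : ∀ i, MeasurableSet (A i)) {π : ι → ℝ} (hπ : ∀ i, 0 < π i) (hπ1 : ∀ i, π i ≤ 1)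
    (hsum : ∑' i, ENNReal.ofReal (π i) ≤ 1) {p : ℝ} (hp : 0 < p) (hp1 : p ≤ 1) :
    ∃ E : Set (Fin D → α), MeasurableSet E ∧ ENNReal.ofReal (1 - p) ≤ Measure.pi ν E ∧
      ∀ S ∈ E, ∀ i, ((D : ℝ≥0∞)⁻¹ • ∑ k, ν k).real (A i) ≤
        ({k | S k ∈ A i}.ncard : ℝ) / D + Real.sqrt ((-Real.log (π i) - Real.log p) / (2 * D)) := by
  have hD' : (0 : ℝ) < D := by exact_mod_cast hD
  let c : ι → ℝ := fun i => -Real.log (π i) - Real.log p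
  have hc : ∀ i, 0 ≤ c i := fun i => by
    have h1 := Real.log_nonpos (hπ i).le (hπ1 i)
    have h2 := Real.log_nonpos hp.le hp1
    simp only [c]
    linarith
  -- This threshold turns the Hoeffding bound `exp (-(2 * t i ^ 2 / D))` into exactly `π i * p`.
  let t : ι → ℝ := fun i => Real.sqrt (D * c i / 2)
  let B : ι → Set (Fin D → α) := fun i =>
    {S | t i ≤ ∑ k, ((ν k).real (A i) - (A i).indicator 1 (S k))}
  have hB : ∀ i, MeasurableSet (B i) := fun i => measurableSet_le measurable_const
    (Finset.measurable_sum _ fun k _ => measurable_const.sub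
      ((measurable_one.indicator (hA i)).comp (measurable_pi_apply k)))
  have hBm : ∀ i, Measure.pi ν (B i) ≤ ENNReal.ofReal (π i) * ENNReal.ofReal p := by
    intro i
    have h := measure_pi_deviation_le ν hD (hA i) (Real.sqrt_nonneg (D * c i / 2))
    rw [Real.sq_sqrt (by have := hc i; positivity),
      show -(2 * (D * c i / 2) / (D : ℝ)) = Real.log (π i) + Real.log p by
        simp only [c]; field_simp; ring, Real.exp_add, Real.exp_log (hπ i), Real.exp_log hp] at h
    rw [← ENNReal.ofReal_mul (hπ i).le, ← ofReal_measureReal]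
    exact ENNReal.ofReal_le_ofReal h
  refine ⟨(⋃ i, B i)ᶜ, (MeasurableSet.iUnion hB).compl, ?_, fun S hS i => ?_⟩
  · rw [prob_compl_eq_one_sub (MeasurableSet.iUnion hB), ENNReal.ofReal_sub _ hp.le,
      ENNReal.ofReal_one]
    refine tsub_le_tsub_left ?_ _
    calc _ ≤ ∑' i, Measure.pi ν (B i) := measure_iUnion_le _
      _ ≤ ∑' i, ENNReal.ofReal (π i) * ENNReal.ofReal p := ENNReal.tsum_le_tsum hBm
      _ = (∑' i, ENNReal.ofReal (π i)) * ENNReal.ofReal p := ENNReal.tsum_mul_right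
      _ ≤ 1 * ENNReal.ofReal p := by gcongr
      _ = _ := one_mul _
  · have hSi : ¬ t i ≤ ∑ k, ((ν k).real (A i) - (A i).indicator 1 (S k)) := fun h =>
      hS (Set.mem_iUnion.2 ⟨i, h⟩)
    rw [not_le, Finset.sum_sub_distrib, sum_indicator_eq_ncard] at hSi
    have hmean : ((D : ℝ≥0∞)⁻¹ • ∑ k, ν k).real (A i) = (∑ k, (ν k).real (A i)) / D := by
      simp only [measureReal_def, Measure.smul_apply, Measure.coe_finsetSum, Finset.sum_apply,
        smul_eq_mul, ENNReal.toReal_mul]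
      rw [ENNReal.toReal_sum fun k _ => measure_ne_top _ _]
      simp [div_eq_inv_mul]
    have ht : Real.sqrt (c i / (2 * D)) = t i / D := by
      rw [show c i / (2 * D) = (D * c i / 2) / D ^ 2 by field_simp, Real.sqrt_div' _ (by positivity),
        Real.sqrt_sq hD'.le]
    change _ ≤ _ + Real.sqrt (c i / (2 * D))
    rw [hmean, ht, ← add_div]
    gcongr
    linarith

end Concentration

/-! ### Margin failures -/

theorem measurableSet_marginFailure {a K : ℕ}
    {g : EuclideanSpace ℝ (Fin a) → EuclideanSpace ℝ (Fin K)} (hg : Continuous g) (ε : ℝ) :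
    MeasurableSet (marginFailure g ε) := by
  have hj : ∀ j, Measurable fun z : Example a K => g z.1 j := fun j =>
    (by fun_prop : Continuous fun x => g x j).measurable.comp measurable_fst
  have : marginFailure g ε = ⋃ y : Fin K, {z | z.2 = y} ∩
      {z : Example a K | g z.1 y ≤ (⨆ j : {j : Fin K // j ≠ y}, g z.1 j) + ε} := by
    ext z
    simp [marginFailure]
  rw [this]
  refine MeasurableSet.iUnion fun y => MeasurableSet.inter ?_ ?_
  · exact measurable_snd (measurableSet_singleton y)
  · exact measurableSet_le (hj y) ((Measurable.iSup fun j : {j : Fin K // j ≠ y} => hj j).add_const ε)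

/-- Predictors that are uniformly close have nested margin failures. -/
theorem mem_marginFailure_of_norm_sub_le {a K : ℕ} (hK : 2 ≤ K)
    {g h : EuclideanSpace ℝ (Fin a) → EuclideanSpace ℝ (Fin K)} {z : Example a K} {ε r : ℝ}
    (hr : ‖g z.1 - h z.1‖ ≤ r) (hz : z ∈ marginFailure g ε) :
    z ∈ marginFailure h (ε + 2 * r) := by
  have hi : ∀ i, |g z.1 i - h z.1 i| ≤ r := fun i => by
    simpa using (abs_apply_le_norm (g z.1 - h z.1) i).trans hr
  have : Nontrivial (Fin K) := Fin.nontrivial_iff_two_le.2 hK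
  obtain ⟨j₀, hj₀⟩ := exists_ne z.2
  have : Nonempty {j : Fin K // j ≠ z.2} := ⟨⟨j₀, hj₀⟩⟩
  have hsup : (⨆ j : {j : Fin K // j ≠ z.2}, g z.1 j) ≤
      (⨆ j : {j : Fin K // j ≠ z.2}, h z.1 j) + r := by
    refine ciSup_le fun j => ?_
    have h1 := le_ciSup (f := fun j : {j : Fin K // j ≠ z.2} => h z.1 j)
      (Set.finite_range _).bddAbove j
    have h2 := (abs_le.1 (hi j)).2
    simp only at h1
    linarith
  have h3 := (abs_le.1 (hi z.2)).1
  simp only [marginFailure, Set.mem_ofPred_eq] at hz ⊢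
  linarith

/-- The zero predictor fails margin `0` at every example, and `g` is within `ε / 2` of it. -/
theorem mem_marginFailure_of_norm_le {a K : ℕ} (hK : 2 ≤ K)
    {g : EuclideanSpace ℝ (Fin a) → EuclideanSpace ℝ (Fin K)} {z : Example a K} {ε : ℝ}
    (h : ‖g z.1‖ ≤ ε / 2) : z ∈ marginFailure g ε := by
  have h0 : z ∈ marginFailure (fun _ => (0 : EuclideanSpace ℝ (Fin K)))
      (a := a) 0 := by
    simp [marginFailure]
  have := mem_marginFailure_of_norm_sub_le hK (h := g) (r := ε / 2) (by simpa using h) h0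
  rwa [show 0 + 2 * (ε / 2) = ε by ring] at this

/-! ### Representative predictors and their prior -/

/-- Fineness of the grid for the vectors describing a layer, at scale `N + 1`. -/
def gridSize (d L N : ℕ) : ℕ := 24 * d ^ 2 * (L * (N + 1))

/-- Fineness of the grid for the activations, at scale `N + 1`. -/
def actSize (d L N : ℕ) : ℕ := 36 * d * (L * (N + 1))

/-- Precision of the low rank approximation of a layer, at scale `N + 1`. -/
def rankTol (L N : ℕ) : ℝ := 1 / (24 * (L * (N + 1)))

/-- Indices of the representative predictors: a scale, the near ranks of the layers, and the
description of a normalised network. -/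
abbrev PredIndex (n : ℕ → ℕ) (L d : ℕ) : Type :=
  (i : ℕ × (Fin L → Fin (d + 1))) ×
    NetCode n L (fun l => (i.2 l : ℕ)) (gridSize d L i.1) (actSize d L i.1)

/-- The prior weight of a representative predictor. -/
def priorWeight (n : ℕ → ℕ) (L d : ℕ) (z : PredIndex n L d) : ℝ :=
  (1 / 2) ^ (z.1.1 + 1) / (((d : ℝ) + 1) ^ L *
    Fintype.card (NetCode n L (fun l => (z.1.2 l : ℕ)) (gridSize d L z.1.1) (actSize d L z.1.1)))

theorem priorWeight_pos (L d : ℕ) (z : PredIndex n L d) : 0 < priorWeight n L d z := by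
  unfold priorWeight
  have : 0 < Fintype.card (NetCode n L (fun l => (z.1.2 l : ℕ)) (gridSize d L z.1.1)
    (actSize d L z.1.1)) := Fintype.card_pos_iff.2 ⟨z.2⟩
  positivity

/-- The prior is geometric in the scale, uniform over the `(d + 1) ^ L` rank vectors, and uniform
over the descriptions with given scale and ranks. -/
theorem tsum_priorWeight_le (L d : ℕ) :
    ∑' z, ENNReal.ofReal (priorWeight n L d z) ≤ 1 := by
  have inner_sum : ∀ i : ℕ × (Fin L → Fin (d + 1)),
      ∑' c : NetCode n L (fun l => (i.2 l : ℕ)) (gridSize d L i.1) (actSize d L i.1),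
        ENNReal.ofReal (priorWeight n L d ⟨i, c⟩) =
      ENNReal.ofReal ((1 / 2) ^ (i.1 + 1) / ((d : ℝ) + 1) ^ L) := by
    intro i
    have hconst : ∀ c : NetCode n L (fun l => (i.2 l : ℕ)) (gridSize d L i.1) (actSize d L i.1),
        ENNReal.ofReal (priorWeight n L d ⟨i, c⟩) =
        ENNReal.ofReal ((1 / 2) ^ (i.1 + 1) / (((d : ℝ) + 1) ^ L *
          Fintype.card (NetCode n L (fun l => (i.2 l : ℕ)) (gridSize d L i.1)
            (actSize d L i.1)))) := fun c => rfl
    rw [tsum_congr hconst, tsum_fintype, Finset.sum_const, nsmul_eq_mul, ← ENNReal.ofReal_natCast,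
      ← ENNReal.ofReal_mul (by positivity)]
    have : (Fintype.card (NetCode n L (fun l => (i.2 l : ℕ)) (gridSize d L i.1)
      (actSize d L i.1)) : ℝ) ≠ 0 := by
      exact_mod_cast Fintype.card_ne_zero
    rw [Finset.card_univ]
    congr 1
    field_simp
  rw [ENNReal.tsum_sigma']
  simp_rw [inner_sum]
  rw [ENNReal.tsum_prod']
  have h2 : ∀ N : ℕ, ∑' _k : Fin L → Fin (d + 1),
      ENNReal.ofReal ((1 / 2) ^ (N + 1) / ((d : ℝ) + 1) ^ L) =
      ENNReal.ofReal ((1 / 2) ^ (N + 1)) := by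
    intro N
    rw [tsum_fintype, Finset.sum_const, nsmul_eq_mul, ← ENNReal.ofReal_natCast,
      ← ENNReal.ofReal_mul (by positivity)]
    congr 1
    have : ((d : ℝ) + 1) ^ L ≠ 0 := by positivity
    simp
    field_simp
  simp_rw [h2]
  have hs : Summable fun N : ℕ => ((1 : ℝ) / 2) ^ (N + 1) :=
    (summable_nat_add_iff 1).2 summable_geometric_two
  rw [← ENNReal.ofReal_tsum_of_nonneg (fun N => by positivity) hs]
  simp_rw [pow_succ]
  rw [tsum_mul_right, tsum_geometric_two]
  norm_num

theorem priorWeight_le_one (L d : ℕ) (z : PredIndex n L d) : priorWeight n L d z ≤ 1 := by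
  have h := (ENNReal.le_tsum (f := fun z => ENNReal.ofReal (priorWeight n L d z)) z).trans
    (tsum_priorWeight_le L d)
  simpa using h

open Classical in
/-- The predictor representing all networks with the description `z`. -/
def repPredictor (n : ℕ → ℕ) (L d : ℕ) (Ln ε : ℝ) (z : PredIndex n L d)
    (x : EuclideanSpace ℝ (Fin (n 0))) : EuclideanSpace ℝ (Fin (n L)) :=
  if h : ∃ a : (ℕ → ℝ → ℝ) × Weights n,
      IsCodable L (fun l => (z.1.2 l : ℕ)) (rankTol L z.1.1) a.1 a.2 ∧
      netCode L (fun l => (z.1.2 l : ℕ)) (gridSize d L z.1.1) (actSize d L z.1.1)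
        (rankTol L z.1.1) a.1 a.2 = z.2 then
    (((z.1.1 : ℝ) + 1) * ε) • network h.choose.1 h.choose.2 L (Ln⁻¹ • x)
  -- Descriptions realised by no network still carry prior weight; any continuous predictor serves
  -- for them.
  else 0

theorem continuous_repPredictor (L d : ℕ) (Ln ε : ℝ) (z : PredIndex n L d) :
    Continuous (repPredictor n L d Ln ε z) := by
  unfold repPredictor
  split_ifs with h
  · have hnet := continuous_network h.choose_spec.1.lipschitz h.choose.2 L
    fun_prop
  · exact continuous_const

/-- The tolerances are chosen so that low rank truncation, vector rounding and activation rounding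
each cost `1 / (12 * L * (N + 1))` per layer. Over `L` layers and at scale `(N + 1) * ε` this sums
to `ε / 4`. -/
theorem exists_norm_sub_repPredictor_le {L d : ℕ} (hL : 1 ≤ L) (hd : 1 ≤ d)
    (hn : ∀ l ≤ L, n l ≤ d) {Ln ε : ℝ} (hε : 0 < ε) (N : ℕ) (k : Fin L → Fin (d + 1))
    {g : ℕ → ℝ → ℝ} {W : Weights n} (h : IsCodable L (fun l => (k l : ℕ)) (rankTol L N) g W) :
    ∃ c, ∀ x : EuclideanSpace ℝ (Fin (n 0)), ‖x‖ ≤ Ln →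
      ‖(((N : ℝ) + 1) * ε) • network g W L (Ln⁻¹ • x) -
        repPredictor n L d Ln ε ⟨(N, k), c⟩ x‖ ≤ ε / 4 := by
  have hd' : (0 : ℝ) < d := by exact_mod_cast hd
  have hL' : (0 : ℝ) < L := by exact_mod_cast hL
  refine ⟨netCode L (fun l => (k l : ℕ)) (gridSize d L N) (actSize d L N) (rankTol L N) g W,
    fun x hx => ?_⟩
  have hex : ∃ a : (ℕ → ℝ → ℝ) × Weights n,
      IsCodable L (fun l => (k l : ℕ)) (rankTol L N) a.1 a.2 ∧
      netCode L (fun l => (k l : ℕ)) (gridSize d L N) (actSize d L N)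
        (rankTol L N) a.1 a.2 =
      netCode L (fun l => (k l : ℕ)) (gridSize d L N) (actSize d L N) (rankTol L N) g W :=
    ⟨(g, W), h, rfl⟩
  rw [repPredictor, dif_pos hex, ← smul_sub, norm_smul, Real.norm_of_nonneg (by positivity)]
  have hx1 : ‖Ln⁻¹ • x‖ ≤ 1 := by
    rw [norm_smul, norm_inv, Real.norm_of_nonneg ((norm_nonneg x).trans hx), inv_mul_eq_div]
    exact div_le_one_of_le₀ hx ((norm_nonneg x).trans hx)
  have := norm_network_sub_le_of_netCode_eq (by unfold rankTol; positivity)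
    (by unfold gridSize; positivity) (by unfold actSize; positivity) hn
    (fun l => Nat.lt_succ_iff.1 (k l).2) h hex.choose_spec.1 hex.choose_spec.2.symm hx1
  refine (mul_le_mul_of_nonneg_left this (by positivity)).trans_eq ?_
  simp only [rankTol, gridSize, actSize]
  push_cast
  field_simp
  norm_num

/-! ### Normalisation of a network -/

theorem exists_normalized_network {L d : ℕ} (hL : 1 ≤ L) (hn : ∀ l ≤ L, n l ≤ d)
    {φ : ℕ → ℝ → ℝ} (hφ : ∀ l, LipschitzWith 1 (φ l)) (hφ0 : ∀ l, φ l 0 = 0) {Ln ε : ℝ}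
    (hε : 0 < ε) (hLn : 0 ≤ Ln) {v : Weights n} {t F : ℕ → ℝ} (ht : ∀ l < L, 0 < t l)
    (hv : ∀ l < L, specNorm (v l) ≤ t l) (hF : ∀ l < L, frobNorm (v l) ≤ F l * t l)
    (hbig : ε / 2 ≤ (∏ l ∈ Finset.range L, t l) * Ln) :
    ∃ (N : ℕ) (k : Fin L → Fin (d + 1)) (g : ℕ → ℝ → ℝ) (W : Weights n),
      IsCodable L (fun l => (k l : ℕ)) (rankTol L N) g W ∧
      (∀ x, network φ v L x = (((N : ℝ) + 1) * ε) • network g W L (Ln⁻¹ • x)) ∧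
      ((N : ℝ) + 1) * ε ≤ 3 * ((∏ l ∈ Finset.range L, t l) * Ln) ∧
      ∀ l : Fin L, ((k l : ℕ) : ℝ) * rankTol L N ^ 2 ≤ F l ^ 2 := by
  set B := (∏ l ∈ Finset.range L, t l) * Ln with hB
  have hB0 : 0 < B := by linarith
  have hLn0 : Ln ≠ 0 := by
    rintro rfl
    simp [hB] at hB0
  have hL' : (0 : ℝ) < L := by exact_mod_cast hL
  obtain ⟨N, hN⟩ : ∃ N, ⌈B / ε⌉₊ = N + 1 :=
    Nat.exists_eq_succ_of_ne_zero (Nat.ceil_pos.2 (by positivity)).ne'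
  have hN1 : B ≤ ((N : ℝ) + 1) * ε := by
    have := Nat.le_ceil (B / ε)
    rw [hN, div_le_iff₀ hε] at this
    exact_mod_cast this
  -- Rounding up adds at most `ε`, which is at most `2 * B` by `hbig`.
  have hN2 : ((N : ℝ) + 1) * ε ≤ 3 * B := by
    have := (Nat.ceil_lt_add_one (a := B / ε) (by positivity)).le
    rw [hN] at this
    push_cast at this
    have h2 := mul_le_mul_of_nonneg_right this hε.le
    rw [add_mul (B / ε), div_mul_cancel₀ _ hε.ne'] at h2
    linarith
  obtain ⟨L', rfl⟩ : ∃ L', L = L' + 1 := Nat.exists_eq_succ_of_ne_zero (by lia)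
  let r : ℝ := ((N : ℝ) + 1) * ε / B
  have hr : 1 ≤ r := (one_le_div hB0).2 hN1
  -- The last layer absorbs the rounding factor `r ≥ 1`, so that the total scale is exactly `(N + 1)
  -- * ε` while all normalised norms only decrease.
  let t' : ℕ → ℝ := fun l => if l = L' then t l * r else t l
  have htt' : ∀ l < L' + 1, t l ≤ t' l := by
    intro l hl
    simp only [t']
    split_ifs
    · exact le_mul_of_one_le_right (ht l hl).le hr
    · exact le_rfl
  have ht' : ∀ l < L' + 1, 0 < t' l := fun l hl => (ht l hl).trans_le (htt' l hl)
  have hprod : Ln * ∏ l ∈ Finset.range (L' + 1), t' l = ((N : ℝ) + 1) * ε := by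
    have h1 : ∏ l ∈ Finset.range L', t' l = ∏ l ∈ Finset.range L', t l :=
      Finset.prod_congr rfl fun l hl => if_neg (Finset.mem_range.1 hl).ne
    have h2 : t' L' = t L' * r := if_pos rfl
    rw [Finset.prod_range_succ, h1, h2, ← mul_assoc (∏ l ∈ _, _), ← Finset.prod_range_succ,
      mul_comm, mul_right_comm, ← hB]
    simp only [r]
    field_simp
  let W : Weights n := fun l => (t' l)⁻¹ • v l
  have hWs : ∀ l < L' + 1, specNorm (W l) ≤ 1 := by
    intro l hl
    rw [specNorm_smul, abs_of_pos (inv_pos.2 (ht' l hl)), inv_mul_eq_div]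
    exact div_le_one_of_le₀ ((hv l hl).trans (htt' l hl)) (ht' l hl).le
  have hWF : ∀ l < L' + 1, frobNorm (W l) ≤ F l := by
    intro l hl
    rw [frobNorm_smul, abs_of_pos (inv_pos.2 (ht' l hl)), inv_mul_eq_div, div_le_iff₀ (ht' l hl)]
    have hF0 : 0 ≤ F l := nonneg_of_mul_nonneg_left ((frobNorm_nonneg _).trans (hF l hl)) (ht l hl)
    exact (hF l hl).trans (mul_le_mul_of_nonneg_left (htt' l hl) hF0)
  have hδ : 0 < rankTol (L' + 1) N := by unfold rankTol; positivity
  choose k hk1 hk2 hk3 using fun l : Fin (L' + 1) => exists_isNearRank (W l) hδ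
  refine ⟨N, fun l => ⟨k l, Nat.lt_succ_iff.2 ((hk1 l).trans (hn l l.2.le))⟩, _, W,
    ⟨fun l => lipschitzWith_rescale (hφ l) (Ln * ∏ i ∈ Finset.range (l + 1), t' i),
      fun l => by simp [hφ0 l], hWs, hk3⟩, fun x => ?_, hN2, fun l => ?_⟩
  · rw [network_rescale φ v hLn0 x (L' + 1) fun i hi => (ht' i hi).ne', hprod]
  · exact (hk2 l).trans (pow_le_pow_left₀ (frobNorm_nonneg _) (hWF l l.2) 2)

/-! ### Length of the descriptions -/

theorem log_two_le_log_mul {L d : ℕ} (hL : 1 ≤ L) (hd : 2 ≤ d) :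
    Real.log 2 ≤ Real.log (d * L) := by
  have hL1 : (1 : ℝ) ≤ L := by exact_mod_cast hL
  have hd2 : (2 : ℝ) ≤ d := by exact_mod_cast hd
  exact Real.log_le_log two_pos (by nlinarith)

theorem log_gridSize_le {L d : ℕ} (hL : 1 ≤ L) (hd : 2 ≤ d) (N : ℕ) :
    Real.log (2 * gridSize d L N + 1) ≤ 8 * Real.log (d * L) + Real.log (N + 1) := by
  have hL1 : (1 : ℝ) ≤ L := by exact_mod_cast hL
  have hd2 : (2 : ℝ) ≤ d := by exact_mod_cast hd
  have hlog2 := log_two_le_log_mul hL hd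
  have h1 : (2 * gridSize d L N + 1 : ℝ) ≤ 2 ^ 6 * (d * L) ^ 2 * (N + 1) := by
    have hN : (1 : ℝ) ≤ N + 1 := by linarith [N.cast_nonneg (α := ℝ)]
    have h4 : (1 : ℝ) ≤ d ^ 2 * (L ^ 2 * (N + 1)) :=
      one_le_mul_of_one_le_of_one_le (one_le_pow₀ (by linarith))
        (one_le_mul_of_one_le_of_one_le (one_le_pow₀ hL1) hN)
    have h5 : (L : ℝ) ≤ L ^ 2 := le_self_pow₀ hL1 two_ne_zero
    have h6 : (d : ℝ) ^ 2 * (L * (N + 1)) ≤ d ^ 2 * (L ^ 2 * (N + 1)) := by gcongr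
    simp only [gridSize]
    push_cast
    linarith
  refine (Real.log_le_log (by positivity) h1).trans ?_
  have h0 : (0 : ℝ) < d * L := by positivity
  rw [Real.log_mul (by positivity) (by positivity), Real.log_mul (by positivity) (by positivity),
    Real.log_pow, Real.log_pow]
  push_cast
  linarith

/-- Bounding `log (N + 1)` by `N + 1` is affordable: the activation tables of all layers have about
`d * L ^ 2 * (N + 1)` entries, so the extra factor only completes `(N + 1) ^ 2`. -/
theorem log_actSize_le {L d : ℕ} (hL : 1 ≤ L) (hd : 2 ≤ d) (N : ℕ) :
    Real.log (2 * actSize d L N + 1) ≤ 10 * (((N : ℝ) + 1) * Real.log (d * L)) := by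
  have hL1 : (1 : ℝ) ≤ L := by exact_mod_cast hL
  have hd2 : (2 : ℝ) ≤ d := by exact_mod_cast hd
  have hN : (1 : ℝ) ≤ N + 1 := by linarith [N.cast_nonneg (α := ℝ)]
  have hlog2 := log_two_le_log_mul hL hd
  have hℓ2 : 1 / 2 ≤ Real.log (d * L) := by linarith [Real.log_two_gt_d9]
  have h1 : (2 * actSize d L N + 1 : ℝ) ≤ 2 ^ 7 * (d * L) * (N + 1) := by
    have h4 : (1 : ℝ) ≤ d * (L * (N + 1)) :=
      one_le_mul_of_one_le_of_one_le (by linarith) (one_le_mul_of_one_le_of_one_le hL1 hN)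
    simp only [actSize]
    push_cast
    linarith
  have hlogN : Real.log ((N : ℝ) + 1) ≤ N + 1 :=
    (Real.log_le_sub_one_of_pos (by linarith)).trans (by linarith)
  refine (Real.log_le_log (by positivity) h1).trans ?_
  have h0 : (0 : ℝ) < d * L := by positivity
  rw [Real.log_mul (by positivity) (by positivity), Real.log_mul (by positivity) (by positivity),
    Real.log_pow]
  push_cast
  have h2 := mul_le_mul_of_nonneg_left hℓ2 (show (0 : ℝ) ≤ N + 1 by linarith)
  have h3 : Real.log (d * L) ≤ (N + 1) * Real.log (d * L) :=
    le_mul_of_one_le_left (by linarith) hN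
  linarith

/-- The cost of a layer of near rank `k`. -/
theorem nearRank_mul_log_le {L d : ℕ} (hL : 1 ≤ L) (hd : 2 ≤ d) {N k : ℕ} {r : ℝ} (hr : 1 ≤ r)
    (hkd : k ≤ d) (hk : k * rankTol L N ^ 2 ≤ 4 * r) :
    k * Real.log (2 * gridSize d L N + 1) ≤
      20736 * ((L * ((N : ℝ) + 1)) ^ 2 * Real.log (d * L)) * r := by
  set X : ℝ := (N : ℝ) + 1 with hX
  set T : ℝ := L * X with hT
  set ℓ := Real.log (d * L) with hℓ
  have hX1 : 1 ≤ X := by rw [hX]; linarith [N.cast_nonneg (α := ℝ)]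
  have hL1 : (1 : ℝ) ≤ L := by exact_mod_cast hL
  have hd2 : (2 : ℝ) ≤ d := by exact_mod_cast hd
  have hXT : X ≤ T := le_mul_of_one_le_left (by linarith) hL1
  have hℓ2 : 1 / 2 ≤ ℓ := by linarith [Real.log_two_gt_d9, log_two_le_log_mul hL hd]
  have hlogX : Real.log X ≤ X := (Real.log_le_sub_one_of_pos (by linarith)).trans (by linarith)
  have hlogX0 : 0 ≤ Real.log X := Real.log_nonneg hX1
  have hk1 : (k : ℝ) ≤ 2304 * T ^ 2 * r := by
    simp only [rankTol] at hk
    rw [← hX, ← hT, div_pow, one_pow, mul_one_div, div_le_iff₀ (by positivity)] at hk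
    calc _ ≤ _ := hk
      _ = _ := by ring
  have hk0 : (0 : ℝ) ≤ k := Nat.cast_nonneg _
  have hkd' : (k : ℝ) ≤ d := by exact_mod_cast hkd
  -- This removes any logarithm of the scale from the final bound. For `X ≤ d` it is dominated by
  -- `log (d * L)`; for `X ≥ d` the rank satisfies `k ≤ d ≤ X`, and `X * log X ≤ X ^ 2` is absorbed
  -- by `T ^ 2`.
  have hkX : k * Real.log X ≤ 2304 * (T ^ 2 * ℓ) * r := by
    rcases le_total X d with hXd | hXd
    · have h1 : Real.log X ≤ ℓ := Real.log_le_log (by linarith)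
        (hXd.trans (le_mul_of_one_le_right (by linarith) hL1))
      calc _ ≤ 2304 * T ^ 2 * r * ℓ := mul_le_mul hk1 h1 hlogX0 (by positivity)
        _ = _ := by ring
    · have h3 : T ^ 2 * (1 / 2) ≤ T ^ 2 * ℓ := mul_le_mul_of_nonneg_left hℓ2 (sq_nonneg T)
      calc _ ≤ X * X := mul_le_mul (hkd'.trans hXd) hlogX hlogX0 (by linarith)
        _ ≤ T * T := mul_le_mul hXT hXT (by linarith) (by linarith)
        _ ≤ 2304 * (T ^ 2 * ℓ) * 1 := by linarith [sq_nonneg T]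
        _ ≤ _ := mul_le_mul_of_nonneg_left hr (by positivity)
  calc _ ≤ k * (8 * ℓ + Real.log X) := mul_le_mul_of_nonneg_left (log_gridSize_le hL hd N) hk0
    _ = 8 * ℓ * k + k * Real.log X := by ring
    _ ≤ 8 * ℓ * (2304 * T ^ 2 * r) + 2304 * (T ^ 2 * ℓ) * r :=
        add_le_add (mul_le_mul_of_nonneg_left hk1 (by positivity)) hkX
    _ = _ := by ring

theorem neg_log_priorWeight_eq_le {L d : ℕ} (hn : ∀ l ≤ L, n l ≤ d) (z : PredIndex n L d) :
    -Real.log (priorWeight n L d z) ≤ ((z.1.1 : ℝ) + 1) * Real.log 2 + L * Real.log (d + 1) +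
      2 * d * (∑ l, ((z.1.2 l : ℕ) : ℝ) * Real.log (2 * gridSize d L z.1.1 + 1)) +
        (2 * actSize d L z.1.1 + 1) * L * Real.log (2 * actSize d L z.1.1 + 1) := by
  obtain ⟨⟨N, k⟩, c⟩ := z
  have hpos : (0 : ℝ) < Fintype.card (NetCode n L (fun l => (k l : ℕ)) (gridSize d L N)
      (actSize d L N)) := by
    exact_mod_cast Fintype.card_pos_iff.2 ⟨c⟩
  have h := Real.log_le_log hpos
    (Nat.cast_le (α := ℝ).2 (card_netCode_le (n := n) (k := fun l => (k l : ℕ))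
      (q := gridSize d L N) (M := actSize d L N) hn))
  push_cast at h
  rw [Real.log_mul (by positivity) (by positivity), Real.log_pow, Real.log_pow] at h
  push_cast at h
  have hw : -Real.log (priorWeight n L d ⟨(N, k), c⟩) =
      ((N : ℝ) + 1) * Real.log 2 + L * Real.log (d + 1) +
      Real.log (Fintype.card (NetCode n L (fun l => (k l : ℕ)) (gridSize d L N)
        (actSize d L N))) := by
    simp only [priorWeight]
    rw [Real.log_div (by positivity) (by positivity), Real.log_mul (by positivity) hpos.ne',
      Real.log_pow, Real.log_pow, one_div, Real.log_inv]
    push_cast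
    ring
  rw [hw, ← Finset.sum_mul]
  linarith

theorem neg_log_priorWeight_le {L d : ℕ} (hL : 1 ≤ L) (hd : 2 ≤ d) (hn : ∀ l ≤ L, n l ≤ d)
    {R : ℕ → ℝ} (hR : ∀ l < L, 1 ≤ R l) (z : PredIndex n L d)
    (hk : ∀ l : Fin L, ((z.1.2 l : ℕ) : ℝ) * rankTol L z.1.1 ^ 2 ≤ 4 * R l) :
    -Real.log (priorWeight n L d z) ≤
      42205 * (L ^ 2 * ((z.1.1 : ℝ) + 1) ^ 2 * d * Real.log (d * L) *
        ∑ l ∈ Finset.range L, R l) := by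
  refine (neg_log_priorWeight_eq_le hn z).trans ?_
  have hlayer : ∀ l : Fin L, _ := fun l => nearRank_mul_log_le hL hd (hR l l.2)
    (Nat.lt_succ_iff.1 (z.1.2 l).2) (hk l)
  have hlogM := log_actSize_le hL hd z.1.1
  generalize z.1.1 = N at hlayer hlogM ⊢
  have hsumk : ∑ l, ((z.1.2 l : ℕ) : ℝ) * Real.log (2 * gridSize d L N + 1) ≤
      20736 * ((L * ((N : ℝ) + 1)) ^ 2 * Real.log (d * L)) * ∑ l ∈ Finset.range L, R l := by
    rw [← Fin.sum_univ_eq_sum_range, Finset.mul_sum]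
    exact Finset.sum_le_sum fun l _ => hlayer l
  have hL1 : (1 : ℝ) ≤ L := by exact_mod_cast hL
  have hS1 : 1 ≤ ∑ l ∈ Finset.range L, R l := by
    have : ∑ _l ∈ Finset.range L, (1 : ℝ) ≤ ∑ l ∈ Finset.range L, R l :=
      Finset.sum_le_sum fun l hl => hR l (Finset.mem_range.1 hl)
    refine hL1.trans (by simpa using this)
  have hlog2 := log_two_le_log_mul hL hd
  clear hlayer hk hR
  generalize ∑ l ∈ Finset.range L, R l = S at hsumk hS1 ⊢
  generalize ∑ l, ((z.1.2 l : ℕ) : ℝ) * Real.log (2 * gridSize d L N + 1) = K at hsumk ⊢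
  have hd2 : (2 : ℝ) ≤ d := by exact_mod_cast hd
  have hM : (2 * actSize d L N + 1 : ℝ) = 72 * d * (L * (N + 1)) + 1 := by
    simp only [actSize]
    push_cast
    ring
  rw [hM] at hlogM ⊢
  set X : ℝ := (N : ℝ) + 1 with hX
  set T : ℝ := L * X with hT
  set ℓ := Real.log (d * L) with hℓ
  have hX1 : 1 ≤ X := by rw [hX]; linarith [N.cast_nonneg (α := ℝ)]
  have hT1 : 1 ≤ T := one_le_mul_of_one_le_of_one_le hL1 hX1
  have hTT : T ≤ T ^ 2 := le_self_pow₀ hT1 two_ne_zero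
  have hℓ2 : 1 / 2 ≤ ℓ := by linarith [Real.log_two_gt_d9]
  have hbase : d * T ^ 2 * ℓ ≤ d * T ^ 2 * ℓ * S := le_mul_of_one_le_right (by positivity) hS1
  have hact : (72 * d * T + 1) * L * Real.log (72 * d * T + 1) ≤ 730 * (d * T ^ 2 * ℓ) := by
    have h1 : 72 * d * T + 1 ≤ 73 * (d * T) := by
      have : 1 ≤ (d : ℝ) * T := one_le_mul_of_one_le_of_one_le (by linarith) hT1
      linarith
    calc _ ≤ 73 * (d * T) * L * (10 * (X * ℓ)) :=
          mul_le_mul (mul_le_mul_of_nonneg_right h1 (by positivity)) hlogM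
            (Real.log_nonneg (by linarith [show 0 ≤ 72 * d * T by positivity])) (by positivity)
      _ = _ := by rw [hT]; ring
  have hXb : X * Real.log 2 ≤ d * T ^ 2 * ℓ := by
    have hXT : X ≤ T := le_mul_of_one_le_left (by linarith) hL1
    have : T ^ 2 ≤ d * T ^ 2 := le_mul_of_one_le_left (by positivity) (by linarith)
    exact mul_le_mul (by linarith) hlog2 (Real.log_nonneg one_le_two) (by positivity)
  have hLb : L * Real.log (d + 1) ≤ 2 * (d * T ^ 2 * ℓ) := by
    have h1 : Real.log (d + 1) ≤ d := by
      have := Real.log_le_sub_one_of_pos (show (0 : ℝ) < d + 1 by positivity)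
      linarith
    have h2 : (L : ℝ) ≤ T ^ 2 := (le_mul_of_one_le_right (by linarith) hX1).trans hTT
    calc _ ≤ T ^ 2 * (d : ℝ) := mul_le_mul h2 h1 (Real.log_nonneg (by linarith)) (by positivity)
      _ ≤ T ^ 2 * (d : ℝ) * (2 * ℓ) := le_mul_of_one_le_right (by positivity) (by linarith)
      _ = _ := by ring
  have hK : 2 * d * K ≤ 41472 * (d * T ^ 2 * ℓ * S) := by
    calc _ ≤ 2 * (d : ℝ) * (20736 * (T ^ 2 * ℓ) * S) :=
          mul_le_mul_of_nonneg_left hsumk (by positivity)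
      _ = _ := by ring
  have : (L : ℝ) ^ 2 * X ^ 2 * d * ℓ * S = d * T ^ 2 * ℓ * S := by rw [hT]; ring
  rw [this]
  -- The constant is `41472 + 730 + 2 + 1`: layers, activations, choice of ranks, choice of scale.
  linarith

/-! ### From description length to the generalisation bound -/

/-- Relative perturbations of size `1 / L` in every layer enlarge the product of the spectral norms
by at most `e`. -/
theorem one_add_inv_pow_le {L : ℕ} (hL : 1 ≤ L) : (1 + 1 / (L : ℝ)) ^ L ≤ 3 := by
  have hL0 : (L : ℝ) ≠ 0 := by exact_mod_cast (by lia : L ≠ 0)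
  have h : (1 + 1 / (L : ℝ)) ^ L ≤ Real.exp (1 / L) ^ L :=
    pow_le_pow_left₀ (by positivity) (by rw [add_comm]; exact Real.add_one_le_exp _) L
  rw [← Real.exp_nat_mul, mul_one_div_cancel hL0] at h
  linarith [Real.exp_one_lt_d9]

/-- A predictor that is close to a second one inherits its generalisation bound, with a loss in the
margin. -/
theorem marginLoss_le_of_close {a K m D : ℕ} (hK : 2 ≤ K) (hD : 0 < D)
    {μ : Fin m → Measure (Example a K)} [∀ i, IsProbabilityMeasure (μ i)] {c : Fin D → Fin m}
    {Ln ε b : ℝ} (hμ : ∀ i, ∀ᵐ z ∂(μ i), ‖z.1‖ ≤ Ln)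
    {f h : EuclideanSpace ℝ (Fin a) → EuclideanSpace ℝ (Fin K)}
    (hfh : ∀ x, ‖x‖ ≤ Ln → ‖f x - h x‖ ≤ ε / 4) {S : Fin D → Example a K}
    (hS : ∀ k, ‖(S k).1‖ ≤ Ln)
    (hdev : (pooledLaw μ c).real (marginFailure h (ε / 2)) ≤
      ({k | S k ∈ marginFailure h (ε / 2)}.ncard : ℝ) / D + b) :
    marginLoss (pooledLaw μ c) f 0 ≤ empMarginLoss S f ε + b := by
  have hD' : (D : ℝ≥0∞)⁻¹ ≠ ∞ := by simp [hD.ne']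
  have hfin : IsFiniteMeasure (pooledLaw μ c) := by
    refine ⟨?_⟩
    simp only [pooledLaw, Measure.smul_apply, Measure.coe_finsetSum, Finset.sum_apply, smul_eq_mul]
    exact ENNReal.mul_lt_top hD'.lt_top (ENNReal.sum_lt_top.2 fun k _ => measure_lt_top _ _)
  have hae : ∀ᵐ z ∂(pooledLaw μ c), ‖z.1‖ ≤ Ln := by
    rw [ae_iff]
    simp only [pooledLaw, Measure.smul_apply, Measure.coe_finsetSum, Finset.sum_apply]
    rw [Finset.sum_eq_zero fun k _ => ae_iff.1 (hμ (c k)), smul_zero]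
  have h1 : marginLoss (pooledLaw μ c) f 0 ≤
      (pooledLaw μ c).real (marginFailure h (ε / 2)) := by
    refine ENNReal.toReal_mono (measure_ne_top _ _) (measure_mono_ae ?_)
    filter_upwards [hae] with z hz hzf
    have := mem_marginFailure_of_norm_sub_le hK (hfh z.1 hz) hzf
    rwa [show 0 + 2 * (ε / 4) = ε / 2 by ring] at this
  have h2 : ({k | S k ∈ marginFailure h (ε / 2)}.ncard : ℝ) / D ≤ empMarginLoss S f ε := by
    refine div_le_div_of_nonneg_right (Nat.cast_le.2 (Set.ncard_le_ncard (fun k hk => ?_)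
      (Set.toFinite _))) D.cast_nonneg
    have := mem_marginFailure_of_norm_sub_le hK (h := f)
      ((norm_sub_rev _ _).le.trans (hfh (S k).1 (hS k))) hk
    rwa [show ε / 2 + 2 * (ε / 4) = ε by ring] at this
  linarith

theorem empMarginLoss_eq_one {a K D : ℕ} (hK : 2 ≤ K) (hD : 0 < D) {ε : ℝ}
    {f : EuclideanSpace ℝ (Fin a) → EuclideanSpace ℝ (Fin K)} {S : Fin D → Example a K}
    (hf : ∀ k, ‖f (S k).1‖ ≤ ε / 2) : empMarginLoss S f ε = 1 := by
  have : {k : Fin D | S k ∈ marginFailure f ε} = Set.univ :=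
    Set.eq_univ_of_forall fun k => mem_marginFailure_of_norm_le hK (hf k)
  rw [empMarginLoss, this, Set.ncard_univ, Nat.card_eq_fintype_card, Fintype.card_fin,
    div_self (by exact_mod_cast hD.ne')]

theorem marginLoss_pooledLaw_le_one {a K m D : ℕ} (hD : 0 < D)
    {μ : Fin m → Measure (Example a K)} [∀ i, IsProbabilityMeasure (μ i)] (c : Fin D → Fin m)
    (f : EuclideanSpace ℝ (Fin a) → EuclideanSpace ℝ (Fin K)) (ε : ℝ) :
    marginLoss (pooledLaw μ c) f ε ≤ 1 := by
  have : IsProbabilityMeasure (pooledLaw μ c) := by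
    refine ⟨?_⟩
    simp only [pooledLaw, Measure.smul_apply, Measure.coe_finsetSum, Finset.sum_apply, smul_eq_mul,
      measure_univ, Finset.sum_const, Finset.card_univ, Fintype.card_fin, nsmul_eq_mul, mul_one]
    exact ENNReal.inv_mul_cancel (by exact_mod_cast hD.ne') (ENNReal.natCast_ne_top D)
  exact measureReal_le_one

/-- The cost of the description of a network is controlled by its spectral complexity. -/
theorem sqrt_cost_le {εmax ε p Ln P R x q X : ℝ} {L d D : ℕ} (hL : 1 ≤ L) (hd : 2 ≤ d)
    (hD : 2 ≤ D) (hε : 0 < ε) (hεmax : ε ≤ εmax) (hp : 0 < p) (hp1 : p ≤ 1) (hR : 0 ≤ R)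
    (hX : X * ε ≤ 9 * (P * Ln)) (hX0 : 0 ≤ X)
    (hq : q ≤ 42205 * (L ^ 2 * X ^ 2 * d * Real.log (d * L) * R)) (hx : x = P ^ 2 * R) :
    Real.sqrt ((q - Real.log p) / (2 * D)) ≤
      Real.sqrt (42205 * 81 + εmax ^ 2) * Real.sqrt
        (((L : ℝ) ^ 2 * Ln ^ 2 * d * Real.log (d * L) * x +
          Real.log (L * D / p)) / (((D : ℝ) - 1) * ε ^ 2)) := by
  have hL1 : (1 : ℝ) ≤ L := by exact_mod_cast hL
  have hd2 : (2 : ℝ) ≤ d := by exact_mod_cast hd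
  have hD2 : (2 : ℝ) ≤ D := by exact_mod_cast hD
  have hℓ : 0 ≤ Real.log (d * L) := Real.log_nonneg (by nlinarith)
  have hlp : 0 ≤ -Real.log p := by linarith [Real.log_nonpos hp.le hp1]
  have hlog : -Real.log p ≤ Real.log (L * D / p) := by
    rw [Real.log_div (by positivity) hp.ne']
    have : 0 ≤ Real.log (L * D) := Real.log_nonneg (by nlinarith)
    linarith
  have hD1 : 0 < (D : ℝ) - 1 := by linarith
  rw [← Real.sqrt_mul (by positivity)]
  refine Real.sqrt_le_sqrt ?_
  set A : ℝ := (L : ℝ) ^ 2 * Ln ^ 2 * d * Real.log (d * L) * x with hA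
  set Y : ℝ := Real.log (L * D / p) with hY
  have hA0 : 0 ≤ A := by rw [hA, hx]; positivity
  have hY0 : 0 ≤ Y := hlp.trans hlog
  have hX2 : X ^ 2 * ε ^ 2 ≤ 81 * (P ^ 2 * Ln ^ 2) := by
    have := pow_le_pow_left₀ (by positivity) hX 2
    nlinarith
  have hqA : q * ε ^ 2 ≤ 42205 * 81 * A := by
    have h1 := mul_le_mul_of_nonneg_right hq (sq_nonneg ε)
    have h2 := mul_le_mul_of_nonneg_left hX2
      (show 0 ≤ 42205 * ((L : ℝ) ^ 2 * d * Real.log (d * L) * R) by positivity)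
    calc _ ≤ _ := h1
      _ = 42205 * ((L : ℝ) ^ 2 * d * Real.log (d * L) * R) * (X ^ 2 * ε ^ 2) := by ring
      _ ≤ _ := h2
      _ = _ := by rw [hA, hx]; ring
  have hε2 : ε ^ 2 ≤ εmax ^ 2 := pow_le_pow_left₀ hε.le hεmax 2
  have hnum : (q - Real.log p) * ε ^ 2 ≤ (42205 * 81 + εmax ^ 2) * (A + Y) := by
    -- The confidence term does not scale with `1 / ε ^ 2`; putting it over `ε ^ 2` is what makes
    -- the constant depend on `εmax`.
    have h1 : -Real.log p * ε ^ 2 ≤ Y * εmax ^ 2 := mul_le_mul hlog hε2 (by positivity) hY0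
    have h2 : 0 ≤ A * εmax ^ 2 := by positivity
    nlinarith
  rw [mul_div_assoc', div_le_div_iff₀ (by positivity) (by positivity)]
  calc _ = ((q - Real.log p) * ε ^ 2) * ((D : ℝ) - 1) := by ring
    _ ≤ ((42205 * 81 + εmax ^ 2) * (A + Y)) * ((D : ℝ) - 1) :=
        mul_le_mul_of_nonneg_right hnum hD1.le
    _ ≤ _ := mul_le_mul_of_nonneg_left (by linarith) (by positivity)

end FedMargin

end

open FedMargin in
theorem theorem4p4 (εmax : ℝ) (hεmax : 0 < εmax) :
    ∃ C : ℝ, 0 < C ∧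
      ∀ (L d : ℕ) (n : ℕ → ℕ) (φ : ℕ → ℝ → ℝ) (m D : ℕ)
        (μ : Fin m → Measure (Example (n 0) (n L))) (c : Fin D → Fin m) (Ln ε p : ℝ),
        1 ≤ L → (∀ l ≤ L, n l ≤ d) → 2 ≤ n L →
        (∀ l, LipschitzWith 1 (φ l)) → (∀ l, φ l 0 = 0) →
        2 ≤ D → (∀ i, IsProbabilityMeasure (μ i)) → (∀ i, ∀ᵐ z ∂(μ i), ‖z.1‖ ≤ Ln) →
        0 < ε → ε ≤ εmax → 0 < p →
        ∃ E : Set (Fin D → Example (n 0) (n L)), MeasurableSet E ∧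
          ENNReal.ofReal (1 - p) ≤ Measure.pi (fun k => μ (c k)) E ∧
          ∀ S ∈ E, ∀ w s : Weights n,
            (∀ l < L, w l ≠ 0) →
            (∀ l < L, specNorm (s l) ≤ specNorm (w l) / L ∧ frobNorm (s l) ≤ frobNorm (w l)) →
            marginLoss (pooledLaw μ c) (network φ (w + s) L) 0 ≤
              empMarginLoss S (network φ (w + s) L) ε +
                C * Real.sqrt
                  (((L : ℝ) ^ 2 * Ln ^ 2 * d * Real.log (d * L) * complexityV L w +
                      Real.log (L * D / p)) / (((D : ℝ) - 1) * ε ^ 2)) := by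
  refine ⟨Real.sqrt (42205 * 81 + εmax ^ 2), by positivity, ?_⟩
  intro L d n φ m D μ c Ln ε p hL hn hK hφ hφ0 hD hμ hball hε hεm hp
  rcases le_or_gt 1 p with hp1 | hp1
  -- For `p ≥ 1` the required probability is zero.
  · exact ⟨∅, MeasurableSet.empty, by simp [hp1], fun S hS => hS.elim⟩
  have hd : 2 ≤ d := hK.trans (hn L le_rfl)
  have hD0 : 0 < D := by lia
  obtain ⟨E, hEm, hEp, hE⟩ := exists_uniform_deviation (fun k => μ (c k)) hD0
    (A := fun z : PredIndex n L d => marginFailure (repPredictor n L d Ln ε z) (ε / 2))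
    (fun z => measurableSet_marginFailure (continuous_repPredictor L d Ln ε z) _)
    (priorWeight_pos L d) (priorWeight_le_one L d) (tsum_priorWeight_le L d) hp hp1.le
  have hballm : MeasurableSet {S : Fin D → Example (n 0) (n L) | ∀ k, ‖(S k).1‖ ≤ Ln} := by
    have : {S : Fin D → Example (n 0) (n L) | ∀ k, ‖(S k).1‖ ≤ Ln} =
        ⋂ k, {S | ‖(S k).1‖ ≤ Ln} := by
      ext S
      simp
    rw [this]
    exact MeasurableSet.iInter fun k => measurableSet_le (by fun_prop) measurable_const
  have hballae : ∀ᵐ S ∂(Measure.pi fun k => μ (c k)), ∀ k, ‖(S k).1‖ ≤ Ln :=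
    ae_all_iff.2 fun k =>
      (measurePreserving_eval (fun k => μ (c k)) k).quasiMeasurePreserving.ae (hball (c k))
  refine ⟨E ∩ {S | ∀ k, ‖(S k).1‖ ≤ Ln}, hEm.inter hballm, ?_, ?_⟩
  · refine hEp.trans (measure_mono_ae ?_)
    filter_upwards [hballae] with S hS hSE
    exact ⟨hSE, hS⟩
  rintro S ⟨hSE, hS⟩ w s hw hs
  have hLn : 0 ≤ Ln := (norm_nonneg _).trans (hS ⟨0, hD0⟩)
  have hw0 : ∀ l < L, 0 < specNorm (w l) := fun l hl => specNorm_pos (hw l hl)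
  have hL0 : (0 : ℝ) < L := by exact_mod_cast hL
  let t : ℕ → ℝ := fun l => (1 + 1 / (L : ℝ)) * specNorm (w l)
  have ht : ∀ l < L, 0 < t l := fun l hl => mul_pos (by positivity) (hw0 l hl)
  have hv : ∀ l < L, specNorm ((w + s) l) ≤ t l := by
    intro l hl
    have h1 := specNorm_add_le (w l) (s l)
    have h2 := (hs l hl).1
    calc _ ≤ _ := h1
      _ ≤ specNorm (w l) + specNorm (w l) / L := by linarith
      _ = t l := by simp only [t]; ring
  -- Below this threshold all outputs on the sample are at most `ε / 2` in norm, so the empirical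
  -- margin loss is already `1`.
  rcases le_or_gt (ε / 2) ((∏ l ∈ Finset.range L, t l) * Ln) with hbig | hsmall
  swap
  · have hone : empMarginLoss S (network φ (w + s) L) ε = 1 := by
      refine empMarginLoss_eq_one hK hD0 fun k => ?_
      refine (norm_network_le hφ hφ0 _ L hv).trans (le_trans ?_ hsmall.le)
      exact mul_le_mul_of_nonneg_left (hS k)
        (Finset.prod_nonneg fun l hl => (ht l (Finset.mem_range.1 hl)).le)
    rw [hone]
    have := marginLoss_pooledLaw_le_one hD0 (μ := μ) c (network φ (w + s) L) 0
    have h2 : 0 ≤ Real.sqrt (42205 * 81 + εmax ^ 2) * Real.sqrt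
      (((L : ℝ) ^ 2 * Ln ^ 2 * d * Real.log (d * L) * complexityV L w +
        Real.log (L * D / p)) / (((D : ℝ) - 1) * ε ^ 2)) := by positivity
    linarith
  -- The factor `2` covers `‖s_l‖_F ≤ ‖w_l‖_F`; squared, it becomes the `4` in the rank budget `4 *
  -- R l`.
  let F : ℕ → ℝ := fun l => 2 * (frobNorm (w l) / specNorm (w l))
  let R : ℕ → ℝ := fun l => frobNorm (w l) ^ 2 / specNorm (w l) ^ 2
  have hF : ∀ l < L, frobNorm ((w + s) l) ≤ F l * t l := by
    intro l hl
    have h1 := frobNorm_add_le (w l) (s l)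
    have h2 := (hs l hl).2
    have h3 : F l * t l = 2 * frobNorm (w l) + 2 * frobNorm (w l) / L := by
      simp only [F, t]
      have := (hw0 l hl).ne'
      field_simp
    have h4 : 0 ≤ 2 * frobNorm (w l) / L := by
      have := frobNorm_nonneg (w l)
      positivity
    rw [h3]
    exact h1.trans (by linarith)
  obtain ⟨N, k, g, W, hcod, hnet, hN, hk⟩ :=
    exists_normalized_network hL hn hφ hφ0 hε hLn ht hv hF hbig
  obtain ⟨code, hcode⟩ := exists_norm_sub_repPredictor_le hL (by lia) hn hε N k hcod (Ln := Ln)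
  have hdev := hE S hSE ⟨(N, k), code⟩
  have hclose : ∀ x, ‖x‖ ≤ Ln →
      ‖network φ (w + s) L x - repPredictor n L d Ln ε ⟨(N, k), code⟩ x‖ ≤ ε / 4 := by
    intro x hx
    rw [hnet]
    exact hcode x hx
  refine (marginLoss_le_of_close hK hD0 hball hclose hS hdev).trans ?_
  have hR : ∀ l < L, 1 ≤ R l := by
    intro l hl
    have := hw0 l hl
    rw [one_le_div (by positivity)]
    exact pow_le_pow_left₀ this.le (specNorm_le_frobNorm _) 2
  have hcost := neg_log_priorWeight_le hL hd hn hR ⟨(N, k), code⟩ fun l => by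
    refine (hk l).trans_eq ?_
    simp only [F, R]
    ring
  have hprod : ∏ l ∈ Finset.range L, t l ≤ 3 * ∏ l ∈ Finset.range L, specNorm (w l) := by
    simp only [t]
    rw [Finset.prod_mul_distrib, Finset.prod_const, Finset.card_range]
    exact mul_le_mul_of_nonneg_right (one_add_inv_pow_le hL)
      (Finset.prod_nonneg fun l _ => specNorm_nonneg _)
  -- The required factor `9` is `3` from rounding the scale up times `3` from the perturbation of
  -- the layers.
  have hfinal := sqrt_cost_le (εmax := εmax) (Ln := Ln) (x := complexityV L w)
    (P := ∏ l ∈ Finset.range L, specNorm (w l)) hL hd hD hε hεm hp hp1.le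
    (Finset.sum_nonneg fun l hl => zero_le_one.trans (hR l (Finset.mem_range.1 hl)))
    (by
      have := mul_le_mul_of_nonneg_right hprod hLn
      linarith)
    (by positivity) hcost (by rw [complexityV, Finset.prod_pow])
  linarith
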